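/- **Setting.** Let $\hat\Gamma$ be a normal-form game with $n\ge 1$ players, finite nonempty action sets $A_1,\dots,A_n$, $A=A_1\times\dots\times A_n$, utilities $u_i:A\to[0,1]$, and a mediator objective $u_0:A\to[0,1]$. In the mediator-augmented game the mediator recommends a profile $r\in A$; each player $i$ sees only $r_i$ and then chooses an action $a_i$. A mediator strategy is a distribution $\mu\in\Delta(A)$, a strategy of player $i$ is a map $x_i:A_i\to\Delta(A_i)$ with set of strategies $X_i$, and $d_i\in X_i$ is the direct strategy (follow the recommendation). Write $u_j(\mu,x)$ for expected values. The terminal nodes are the pairs $(r,a)\in Z:=A\times A$, so $|Z|=|A|^2$, and $\hat x[(r,a)]=\prod_i x_i(a_i\mid r_i)$. An equilibrium is a $\mu$ such that $u_i(\mu,x_i,d_{-i})\le u_i(\mu,d)$ for all $i$ and $x_i\in X_i$; it is optimal if it maximizes $u_0(\mu,d)$ among equilibria, and $u_0^*$ is that maximum. Let $\lambda^*\ge 0$ be any constant such that for every $\lambda\ge\lambda^*$ the solutions $\mu$ of $$\max_{\mu}\ \min_{x\in X_1\times\dots\times X_n}\ u_0(\mu,d)-\lambda\sum_{i=1}^n\big[u_i(\mu,x_i,d_{-i})-u_i(\mu,d)\big]$$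 are exactly the optimal equilibria. **NormalFormSteer$(\alpha,\lambda)$.** In each round $t=1,\dots,T$ a regret minimizer $\mathcal R_0$ of the mediator holds a mixed strategy $\mu^{(t)}$, from which $d^{(t)}\in A$ is drawn, and the players hold strategies $x_i^{(t)}$. * With probability $\alpha$ (exploration), $d^{(t)}$ is ignored, a uniformly random profile $\tilde d$ is recommended, the players play $a$, each player $i$ is paid $1-u_i(a)+\mathbf 1\{a_i=\tilde d_i\}$, and $\mathcal R_0$ receives reward $0$. * Otherwise $d=d^{(t)}$ is recommended, the players play $a$, each player $i$ is paid $u_i(a_i,d_{-i})-u_i(a)-\min_{a_i'\in A_i}[u_i(a_i',d_{-i})-u_i(a_i',a_{-i})]$, and $\mathcal R_0$ receives reward $\frac1\lambda u_0(d)-\sum_i[u_i(a_i,d_{-i})-u_i(d)]$. Let $p_i^{(t)}$ be the expected payment to player $i$ in round $t$, given $\mu^{(t)}$ and $x^{(t)}$. Regrets after $T$ rounds are with respect to expected round utilities (for player $i$: $u_i$ plus payment; for the mediator: the reward passed to $\mathcal R_0$), against the best fixed strategy; the players' regrets are normalized by $1/(P+1)$ with the payment bound $P=3$. Suppose the mediator's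 regret is at most $R_0(T)$ and every player's regret is at most $R(T)$. **Theorem.** Let $b=\max_i|A_i|$ and assume $nb\le|Z|$ (automatic if every player has at least two actions). Let $\epsilon:=(R_0(T)+4nR(T))/T>0$ and $$\alpha=|Z|^{1/3}n^{-2/3}b^{1/3}\epsilon^{2/3},\qquad \lambda=|Z|^{1/3}n^{1/3}b^{1/3}\epsilon^{-1/3},$$ and let $T$ be such that $\alpha\le 1/(2n)$. Put $B:=10\max\{1,\lambda^*\}\,|Z|^{4/3}\epsilon^{1/3}$. 1. For all sequences of strategies $\mu^{(t)},x^{(t)}$ satisfying the regret bounds: the average payment $\frac1T\sum_t p_i^{(t)}$ to every player $i$, the directness gap $\big\|\frac1T\sum_t\hat x^{(t)}-\hat d\big\|_1$ (norm over $Z$), and the optimality gap $u_0^*-\frac1T\sum_t u_0(\mu^{(t)},x^{(t)})$ are all at most $B$; the last bound also holds if $\mu^{(t)}$ is replaced by the actual recommendation distribution $(1-\alpha)\mu^{(t)}+\alpha\,\mathrm{Unif}(A)$. 2. Suppose instead that $\mu^{(t)}$ and $x^{(t)}$ are random, depending arbitrarily on the information available before round $t$, and that the regret bounds hold in expectation against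 every fixed strategy. Then the expected average realized payment to each player, the expected directness gap, and the expected value of $u_0^*-\frac1T\sum_t u_0(a^{(t)})$, where $a^{(t)}$ are the realized action profiles, are all at most $B$. -/

import Mathlib

open MeasureTheory

/-! Mediated normal-form games, the steering protocol, and its performance measures. -/

namespace NFSteer

universe v

/-- Pure action profiles. -/
abbrev Profile {n : ℕ} (A : Fin n → Type v) : Type v := ∀ i, A i

/-- An `n`-player normal-form game with utilities in `[0,1]`, and a mediator objective `u0`
with values in `[0,1]`. -/
structure Game {n : ℕ} (A : Fin n → Type v) where
  u : Fin n → Profile A → ℝ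
  u0 : Profile A → ℝ
  u_mem : ∀ i a, u i a ∈ Set.Icc (0 : ℝ) 1
  u0_mem : ∀ a, u0 a ∈ Set.Icc (0 : ℝ) 1

/-- Terminal nodes of the mediator-augmented game: a profile of recommendations together with
the profile of actions that the players then take. -/
abbrev Terminal {n : ℕ} (A : Fin n → Type v) : Type v := Profile A × Profile A

/-- One round of play: (was it an exploration round?, the profile suggested by the mediator's
regret minimizer, the profile actually recommended, the profile actually played). -/
abbrev Outcome {n : ℕ} (A : Fin n → Type v) : Type v :=
  Bool × Profile A × Profile A × Profile A

/-- The profile played in a round. -/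
def played {n : ℕ} {A : Fin n → Type v} (o : Outcome A) : Profile A := o.2.2.2

section

variable {n : ℕ} {A : Fin n → Type v} [∀ i, Fintype (A i)] [∀ i, DecidableEq (A i)]

/-- Largest number of actions of a player. -/
def maxActions (A : Fin n → Type v) [∀ i, Fintype (A i)] : ℕ :=
  Finset.univ.sup fun i => Fintype.card (A i)

/-- Mediator strategies: distributions over recommendation profiles. -/
def mediatorStrategies (A : Fin n → Type v) [∀ i, Fintype (A i)] [∀ i, DecidableEq (A i)] :
    Set (Profile A → ℝ) :=
  stdSimplex ℝ (Profile A)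

/-- Strategies of player `i`: for each recommendation `r`, a distribution `y r` over actions. -/
def playerStrategies (A : Fin n → Type v) [∀ i, Fintype (A i)] (i : Fin n) :
    Set (A i → A i → ℝ) :=
  {y | ∀ r, y r ∈ stdSimplex ℝ (A i)}

/-- The direct strategies: every player follows its recommendation. -/
def direct (A : Fin n → Type v) [∀ i, DecidableEq (A i)] : ∀ i, A i → A i → ℝ :=
  fun _ r a => if a = r then 1 else 0

/-- `playProb x r a` is the product of the players' sequence-form probabilities at the terminal
node `(r, a)`, that is, the probability that `a` is played when `r` is recommended. -/
def playProb (x : ∀ i, A i → A i → ℝ) (r a : Profile A) : ℝ :=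
  ∏ i, x i (r i) (a i)

/-- Expected value of `f` (a utility function) when the mediator recommends according to `μ` and
the players respond with `x`. -/
def value (f : Profile A → ℝ) (μ : Profile A → ℝ) (x : ∀ i, A i → A i → ℝ) : ℝ :=
  ∑ r, μ r * ∑ a, playProb x r a * f a

namespace Game

variable (G : Game A)

/-- Gain of player `i` from deviating to `y` when all other players are direct. -/
def devGain (μ : Profile A → ℝ) (i : Fin n) (y : A i → A i → ℝ) : ℝ :=
  value (G.u i) μ (Function.update (direct A) i y) - value (G.u i) μ (direct A)

/-- `μ` is an equilibrium: being direct is a Nash equilibrium when the mediator plays `μ`. -/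
def IsEquilibrium (μ : Profile A → ℝ) : Prop :=
  μ ∈ mediatorStrategies A ∧ ∀ i, ∀ y ∈ playerStrategies A i, G.devGain μ i y ≤ 0

/-- `μ` is an equilibrium with the largest mediator objective among all equilibria. -/
def IsOptimalEquilibrium (μ : Profile A → ℝ) : Prop :=
  G.IsEquilibrium μ ∧
    ∀ ν, G.IsEquilibrium ν → value G.u0 ν (direct A) ≤ value G.u0 μ (direct A)

/-- The Lagrangian of the optimal-equilibrium problem. -/
def lagrangian (lam : ℝ) (μ : Profile A → ℝ) (x : ∀ i, A i → A i → ℝ) : ℝ :=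
  value G.u0 μ (direct A) - lam * ∑ i, G.devGain μ i (x i)

/-- The minimum of the Lagrangian over all player strategy profiles (a compact nonempty set). -/
noncomputable def worstValue (lam : ℝ) (μ : Profile A → ℝ) : ℝ :=
  sInf (G.lagrangian lam μ '' {x | ∀ i, x i ∈ playerStrategies A i})

/-- `μ` solves the max-min problem with multiplier `lam`. -/
def IsMaxMin (lam : ℝ) (μ : Profile A → ℝ) : Prop :=
  μ ∈ mediatorStrategies A ∧
    ∀ ν ∈ mediatorStrategies A, G.worstValue lam ν ≤ G.worstValue lam μ

/-- `lamStar` is an exact Lagrange constant: for every `lam ≥ lamStar`, the solutions of the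
max-min problem are exactly the optimal equilibria. -/
def IsExactMultiplier (lamStar : ℝ) : Prop :=
  0 ≤ lamStar ∧
    ∀ lam, lamStar ≤ lam → ∀ μ, G.IsMaxMin lam μ ↔ G.IsOptimalEquilibrium μ

end Game

/-! ### The protocol -/

/-- The law of one round. The regret minimizer suggests `d ∼ μ`. With probability `α` the
suggestion is ignored and a uniformly random profile `r` is recommended; otherwise `r = d` is
recommended. The players respond to `r` with `x`. -/
noncomputable def roundLaw (α : ℝ) (μ : Profile A → ℝ) (x : ∀ i, A i → A i → ℝ) :
    Outcome A → ℝ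
  | (true, d, r, a) => α * μ d * (1 / (Fintype.card (Profile A) : ℝ)) * playProb x r a
  | (false, d, r, a) => (1 - α) * μ d * (if r = d then 1 else 0) * playProb x r a

/-- Expectation over one round. -/
noncomputable def expect (α : ℝ) (μ : Profile A → ℝ) (x : ∀ i, A i → A i → ℝ)
    (f : Outcome A → ℝ) : ℝ :=
  ∑ o, roundLaw α μ x o * f o

/-- The recommendation strategy that results from `μ` and exploration with probability `α`. -/
noncomputable def explored (α : ℝ) (μ : Profile A → ℝ) : Profile A → ℝ :=
  fun r => (1 - α) * μ r + α * (1 / (Fintype.card (Profile A) : ℝ))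

namespace Game

variable (G : Game A)

/-- The payment to player `i`, a function of the realized round only. -/
noncomputable def payment [∀ i, Nonempty (A i)] (i : Fin n) : Outcome A → ℝ
  | (true, _, r, a) => 1 - G.u i a + (if a i = r i then 1 else 0)
  | (false, _, r, a) =>
      G.u i (Function.update r i (a i)) - G.u i a
        - Finset.univ.inf' Finset.univ_nonempty fun a' : A i =>
            G.u i (Function.update r i a') - G.u i (Function.update a i a')

/-- The (bandit) reward passed to the mediator's regret minimizer. -/
noncomputable def mediatorReward (lam : ℝ) : Outcome A → ℝ
  | (true, _, _, _) => 0
  | (false, d, _, a) =>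
      1 / lam * G.u0 d - ∑ i, (G.u i (Function.update d i (a i)) - G.u i d)

/-- Expected utility of player `i`, payments included, in a round in which the regret minimizer
plays `μ`, the other players play as in `x`, and player `i` plays `y`. -/
noncomputable def playerUtility [∀ i, Nonempty (A i)] (α : ℝ) (μ : Profile A → ℝ)
    (x : ∀ i, A i → A i → ℝ) (i : Fin n) (y : A i → A i → ℝ) : ℝ :=
  expect α μ (Function.update x i y) fun o => G.u i (played o) + G.payment i o

/-- Expected reward of the mediator's regret minimizer for playing `ν` in a round in which the
players play `x`. -/
noncomputable def mediatorUtility (α lam : ℝ) (x : ∀ i, A i → A i → ℝ) (ν : Profile A → ℝ) : ℝ :=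
  expect α ν x (G.mediatorReward lam)

/-- The constant `P` bounding the per-round payments, used to normalize the players' regrets. -/
def paymentBound : ℝ := 3

/-- After `T` rounds, the regret of player `i` against every fixed strategy, normalized by
`P + 1`, is at most `B`. -/
def PlayerRegretLE [∀ i, Nonempty (A i)] (α : ℝ) (T : ℕ) (μ : ℕ → Profile A → ℝ)
    (x : ℕ → ∀ i, A i → A i → ℝ) (i : Fin n) (B : ℝ) : Prop :=
  ∀ y ∈ playerStrategies A i,
    1 / (paymentBound + 1) *
      (∑ t ∈ Finset.range T, G.playerUtility α (μ t) (x t) i y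
        - ∑ t ∈ Finset.range T, G.playerUtility α (μ t) (x t) i (x t i)) ≤ B

/-- After `T` rounds, the regret of the mediator against every fixed strategy is at most `B`. -/
def MediatorRegretLE (α lam : ℝ) (T : ℕ) (μ : ℕ → Profile A → ℝ)
    (x : ℕ → ∀ i, A i → A i → ℝ) (B : ℝ) : Prop :=
  ∀ ν ∈ mediatorStrategies A,
    ∑ t ∈ Finset.range T, G.mediatorUtility α lam (x t) ν
      - ∑ t ∈ Finset.range T, G.mediatorUtility α lam (x t) (μ t) ≤ B

/-- Time-averaged (expected) payment to player `i`. -/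
noncomputable def averagePayment [∀ i, Nonempty (A i)] (α : ℝ) (T : ℕ) (μ : ℕ → Profile A → ℝ)
    (x : ℕ → ∀ i, A i → A i → ℝ) (i : Fin n) : ℝ :=
  1 / (T : ℝ) * ∑ t ∈ Finset.range T, expect α (μ t) (x t) (G.payment i)

/-- Difference between the objective at the equilibrium `μStar` and the average objective when
the mediator plays `μ` and the players play `x`. -/
noncomputable def optimalityGap (T : ℕ) (μ : ℕ → Profile A → ℝ) (x : ℕ → ∀ i, A i → A i → ℝ)
    (μStar : Profile A → ℝ) : ℝ :=
  value G.u0 μStar (direct A)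
    - 1 / (T : ℝ) * ∑ t ∈ Finset.range T, value G.u0 (μ t) (x t)

end Game

/-- The `ℓ¹` distance, over terminal nodes, between the average of the players' play and direct
play. -/
noncomputable def directnessGap (T : ℕ) (x : ℕ → ∀ i, A i → A i → ℝ) : ℝ :=
  ∑ z : Terminal A,
    |1 / (T : ℝ) * ∑ t ∈ Finset.range T, playProb (x t) z.1 z.2 - playProb (direct A) z.1 z.2|

/-- A random run of the protocol for `T` rounds. `ℱ t` is the information generated before
round `t`; the mediator's and the players' round-`t` strategies may depend on it in any way (and
so on past realized actions, payments and rewards, and on private randomness). The round-`t`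
outcome is then drawn from the law of the round. -/
structure IsRun {Ω : Type*} {mΩ : MeasurableSpace Ω} (P : Measure Ω) (ℱ : Filtration ℕ mΩ)
    (α : ℝ) (T : ℕ) (μ : ℕ → Ω → Profile A → ℝ) (x : ℕ → Ω → ∀ i, A i → A i → ℝ)
    (o : ℕ → Ω → Outcome A) : Prop where
  med_mem : ∀ t < T, ∀ ω, μ t ω ∈ mediatorStrategies A
  med_meas : ∀ t < T, ∀ r, Measurable[ℱ t] fun ω => μ t ω r
  player_mem : ∀ t < T, ∀ ω i, x t ω i ∈ playerStrategies A i
  player_meas : ∀ t < T, ∀ i r a, Measurable[ℱ t] fun ω => x t ω i r a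
  outcome_meas : ∀ t < T, ∀ w, MeasurableSet[ℱ (t + 1)] (o t ⁻¹' {w})
  outcome_law : ∀ t < T, ∀ w,
    P[(o t ⁻¹' {w}).indicator (fun _ => (1 : ℝ)) | ℱ t]
      =ᵐ[P] fun ω => roundLaw α (μ t ω) (x t ω) w

end

end NFSteer

namespace NFSteer

universe v

set_option linter.unusedSectionVars false

/-! The payments decouple the players. In a normal round, player `i` faces the utility of deviating
while everyone else is direct, up to a term it cannot influence. In an exploration round it faces a
constant minus its probability of disobeying a uniform recommendation (`playerUtility_eq`). The
mediator is charged exactly the players' deviation gains.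

When the mediator's regret against an optimal equilibrium is added to the players' regrets against a
comparator `y`, the gains of the actual strategies therefore cancel. The gains at the equilibrium
have a favourable sign. What remains is `regretCertificate`: an expression in the average mediator
strategy `M` and the average number `δ` of deviations under uniform recommendations, which the
regrets bound by `ε`.

Two comparators suffice. Direct play bounds the mediator's loss at `M` by `2ελ`. A mixture of direct
play with weight `lamStar / lam` on the profile minimizing the Lagrangian at `M` makes the other
terms nonnegative, by exactness of the multiplier, and gives `δ ≤ ε/α + n * lamStar / lam`.
Payments, directness and optimality are all controlled by `δ`, `α` and `ελ`, because uniform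
exploration sees every recommendation. The chosen `α` and `λ` balance the errors
(`bounds_of_parameters`).

The certificate is affine in `(M, δ)`, so it commutes with expectations. The comparators then depend
only on the deterministic strategy `𝔼 M`, and expected regret against fixed strategies is enough.
The deterministic statement is the case of a one-point probability space. -/

theorem one_sub_prod_le {ι : Type*} (s : Finset ι) (x : ι → ℝ) (h0 : ∀ i, 0 ≤ x i)
    (h1 : ∀ i, x i ≤ 1) : 1 - ∏ i ∈ s, x i ≤ ∑ i ∈ s, (1 - x i) := by
  classical
  induction s using Finset.induction_on with
  | empty => simp
  | insert i s hi ih =>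
    rw [Finset.prod_insert hi, Finset.sum_insert hi]
    have hp : ∏ j ∈ s, x j ≤ 1 := Finset.prod_le_one (fun j _ => h0 j) fun j _ => h1 j
    have hp0 : 0 ≤ ∏ j ∈ s, x j := Finset.prod_nonneg fun j _ => h0 j
    nlinarith [h0 i, h1 i]

/-! ### Product play, unilateral deviations, and disobedience under uniform recommendations. -/

section Strategies

variable {n : ℕ} {A : Fin n → Type v} [∀ i, Fintype (A i)] [∀ i, DecidableEq (A i)]

theorem direct_mem (i : Fin n) : direct A i ∈ playerStrategies A i := by
  intro r
  refine ⟨fun a => ?_, ?_⟩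
  · unfold direct; split_ifs <;> norm_num
  · simp [direct]

theorem le_one_of_mem {i : Fin n} {y : A i → A i → ℝ} (hy : y ∈ playerStrategies A i)
    (r a : A i) : y r a ≤ 1 := by
  rw [← (hy r).2]
  exact Finset.single_le_sum (fun c _ => (hy r).1 c) (Finset.mem_univ a)

theorem convexCombination_mem {i : Fin n} {y y' : A i → A i → ℝ}
    (hy : y ∈ playerStrategies A i) (hy' : y' ∈ playerStrategies A i) {s : ℝ} (h0 : 0 ≤ s)
    (h1 : s ≤ 1) : (fun r a => (1 - s) * y r a + s * y' r a) ∈ playerStrategies A i := by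
  intro r
  refine ⟨fun a => ?_, ?_⟩
  · have := (hy r).1 a
    have := (hy' r).1 a
    have : 0 ≤ 1 - s := by linarith
    positivity
  · rw [Finset.sum_add_distrib, ← Finset.mul_sum, ← Finset.mul_sum, (hy r).2, (hy' r).2]
    ring

theorem update_mem {x : ∀ i, A i → A i → ℝ} (hx : ∀ i, x i ∈ playerStrategies A i) {i : Fin n}
    {y : A i → A i → ℝ} (hy : y ∈ playerStrategies A i) (j : Fin n) :
    Function.update x i y j ∈ playerStrategies A j := by
  rcases eq_or_ne j i with rfl | h
  · simpa using hy
  · rw [Function.update_of_ne h]; exact hx j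

theorem playProb_nonneg {x : ∀ i, A i → A i → ℝ} (hx : ∀ i, x i ∈ playerStrategies A i)
    (r a : Profile A) : 0 ≤ playProb x r a :=
  Finset.prod_nonneg fun i _ => (hx i (r i)).1 (a i)

theorem playProb_le_one {x : ∀ i, A i → A i → ℝ} (hx : ∀ i, x i ∈ playerStrategies A i)
    (r a : Profile A) : playProb x r a ≤ 1 :=
  Finset.prod_le_one (fun i _ => (hx i (r i)).1 (a i)) fun i _ => le_one_of_mem (hx i) _ _

theorem sum_prod_eq (g : ∀ i, A i → ℝ) : ∑ a : Profile A, ∏ i, g i (a i) = ∏ i, ∑ c, g i c := by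
  rw [Finset.prod_univ_sum, Fintype.piFinset_univ]

theorem sum_playProb {x : ∀ i, A i → A i → ℝ} (hx : ∀ i, x i ∈ playerStrategies A i)
    (r : Profile A) : ∑ a, playProb x r a = 1 := by
  unfold playProb
  rw [sum_prod_eq fun i => x i (r i)]
  exact Finset.prod_eq_one fun i _ => (hx i (r i)).2

theorem playProb_direct (r a : Profile A) : playProb (direct A) r a = if a = r then 1 else 0 := by
  unfold playProb direct
  rw [Finset.prod_ite_zero]
  simp [funext_iff]

theorem value_direct (f μ : Profile A → ℝ) : value f μ (direct A) = ∑ r, μ r * f r := by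
  simp [value, playProb_direct]

/-- The action of a single player is distributed according to its own strategy. -/
theorem sum_playProb_mul_coord {x : ∀ i, A i → A i → ℝ} (hx : ∀ i, x i ∈ playerStrategies A i)
    (r : Profile A) (i : Fin n) (h : A i → ℝ) :
    ∑ a, playProb x r a * h (a i) = ∑ c, x i (r i) c * h c := by
  have key : ∀ a : Profile A, playProb x r a * h (a i)
      = ∏ j, Function.update (fun j => x j (r j)) i (fun c => x i (r i) c * h c) j (a j) := by
    intro a
    rw [← Finset.mul_prod_erase _ _ (Finset.mem_univ i), playProb,
      ← Finset.mul_prod_erase _ _ (Finset.mem_univ i)]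
    have hrest : ∏ j ∈ Finset.univ.erase i,
        Function.update (fun j => x j (r j)) i (fun c => x i (r i) c * h c) j (a j)
          = ∏ j ∈ Finset.univ.erase i, x j (r j) (a j) :=
      Finset.prod_congr rfl fun j hj => by
        rw [Function.update_of_ne (Finset.ne_of_mem_erase hj)]
    rw [hrest, Function.update_self]
    ring
  rw [Finset.sum_congr rfl fun a _ => key a, sum_prod_eq,
    ← Finset.mul_prod_erase _ _ (Finset.mem_univ i), Function.update_self,
    Finset.prod_eq_one, mul_one]
  intro j hj
  rw [Function.update_of_ne (Finset.ne_of_mem_erase hj)]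
  exact (hx j (r j)).2

/-- Fubini for product play, isolating the coordinate of player `i`. -/
theorem sum_playProb_eq_sum_others (x : ∀ i, A i → A i → ℝ) (r : Profile A) (i : Fin n)
    (f : Profile A → ℝ) :
    ∑ a, playProb x r a * f a
      = ∑ b : (∀ j : {j // j ≠ i}, A j), (∏ j : {j // j ≠ i}, x j (r j) (b j))
          * ∑ c, x i (r i) c * f ((Equiv.piSplitAt i A).symm (c, b)) := by
  rw [← (Equiv.piSplitAt i A).symm.sum_comp, Fintype.sum_prod_type, Finset.sum_comm]
  refine Finset.sum_congr rfl fun b _ => ?_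
  rw [Finset.mul_sum]
  refine Finset.sum_congr rfl fun c _ => ?_
  rw [playProb, Fintype.prod_eq_mul_prod_subtype_ne _ i]
  have h1 : (Equiv.piSplitAt i A).symm (c, b) i = c := by simp [Equiv.piSplitAt]
  have h2 : ∀ j : {j // j ≠ i}, (Equiv.piSplitAt i A).symm (c, b) j = b j := by
    intro j; simp [Equiv.piSplitAt, j.2]
  simp only [h1, h2]
  ring

/-- The expectation of a function of the others' actions does not depend on one's strategy. -/
theorem sum_playProb_update_eq {x : ∀ i, A i → A i → ℝ} (hx : ∀ i, x i ∈ playerStrategies A i)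
    {i : Fin n} {y : A i → A i → ℝ} (hy : y ∈ playerStrategies A i) (r : Profile A)
    {k : Profile A → ℝ} (hk : ∀ a c, k (Function.update a i c) = k a) :
    ∑ a, playProb (Function.update x i y) r a * k a = ∑ a, playProb x r a * k a := by
  rw [sum_playProb_eq_sum_others _ r i, sum_playProb_eq_sum_others _ r i]
  refine Finset.sum_congr rfl fun b _ => ?_
  -- Since `k` ignores coordinate `i`, that coordinate may be frozen at `r i`; the inner sum is then
  -- a total mass, equal to 1 for both strategies.
  have hk' : ∀ c, k ((Equiv.piSplitAt i A).symm (c, b))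
      = k ((Equiv.piSplitAt i A).symm (r i, b)) := by
    intro c
    rw [← hk _ (r i)]
    congr 1
    ext j
    rcases eq_or_ne j i with rfl | h
    · simp [Equiv.piSplitAt]
    · simp [Equiv.piSplitAt, h]
  simp only [hk', ← Finset.sum_mul, (hx i (r i)).2, Function.update_self, (hy (r i)).2]
  congr 1
  refine Finset.prod_congr rfl fun j _ => ?_
  rw [Function.update_of_ne j.2]

/-- The value of a unilateral deviation from direct play. -/
theorem value_update_direct (f μ : Profile A → ℝ) {i : Fin n} {y : A i → A i → ℝ}
    (hy : y ∈ playerStrategies A i) :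
    value f μ (Function.update (direct A) i y)
      = ∑ r, μ r * ∑ c, y (r i) c * f (Function.update r i c) := by
  unfold value
  refine Finset.sum_congr rfl fun r _ => ?_
  congr 1
  have h := sum_playProb_mul_coord (update_mem direct_mem hy) r i fun c => f (Function.update r i c)
  rw [Function.update_self] at h
  rw [← h]
  refine Finset.sum_congr rfl fun a _ => ?_
  by_cases ha : a = Function.update r i (a i)
  · rw [← ha]
  -- Such a profile needs a direct player `j ≠ i` to disobey, which has probability zero.
  · have : ∃ j, a j ≠ Function.update r i (a i) j := by
      by_contra! hc; exact ha (funext hc)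
    obtain ⟨j, hj⟩ := this
    have hji : j ≠ i := by rintro rfl; simp at hj
    rw [Function.update_of_ne hji] at hj
    have : playProb (Function.update (direct A) i y) r a = 0 :=
      Finset.prod_eq_zero (Finset.mem_univ j) (by simp [Function.update_of_ne hji, direct, hj])
    simp [this]

/-- Probability that a player deviates when the recommended profile is uniformly random. -/
noncomputable def deviationProb (i : Fin n) (y : A i → A i → ℝ) : ℝ :=
  ∑ r : Profile A, 1 / (Fintype.card (Profile A) : ℝ) * (1 - y (r i) (r i))

theorem deviationProb_direct (i : Fin n) : deviationProb i (direct A i) = 0 := by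
  simp [deviationProb, direct]

theorem deviationProb_nonneg {i : Fin n} {y : A i → A i → ℝ} (hy : y ∈ playerStrategies A i) :
    0 ≤ deviationProb i y :=
  Finset.sum_nonneg fun r _ =>
    mul_nonneg (by positivity) (by linarith [le_one_of_mem hy (r i) (r i)])

variable [∀ i, Nonempty (A i)]

theorem sum_uniform : ∑ _r : Profile A, 1 / (Fintype.card (Profile A) : ℝ) = 1 := by
  have : (Fintype.card (Profile A) : ℝ) ≠ 0 := by exact_mod_cast Fintype.card_ne_zero
  rw [Finset.sum_const, Finset.card_univ, nsmul_eq_mul, mul_one_div_cancel this]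

theorem uniform_mem : (fun _ => 1 / (Fintype.card (Profile A) : ℝ)) ∈ mediatorStrategies A :=
  ⟨fun _ => by positivity, sum_uniform⟩

theorem deviationProb_le_one {i : Fin n} {y : A i → A i → ℝ} (hy : y ∈ playerStrategies A i) :
    deviationProb i y ≤ 1 := by
  rw [← sum_uniform (A := A)]
  refine Finset.sum_le_sum fun r _ => ?_
  exact mul_le_of_le_one_right (by positivity) (by linarith [(hy (r i)).1 (r i)])

theorem deviationProb_convexCombination_direct (i : Fin n) (y : A i → A i → ℝ) (s : ℝ) :
    deviationProb i (fun r a => (1 - s) * direct A i r a + s * y r a) = s * deviationProb i y := by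
  simp only [deviationProb, direct, if_true, Finset.mul_sum]
  refine Finset.sum_congr rfl fun r _ => by ring

/-- Each coordinate of a uniform profile is uniform. The uniform law on profiles is realized here as
product play of constant uniform strategies, so that `sum_playProb_mul_coord` computes the marginal.
-/
theorem deviationProb_eq_card (i : Fin n) (y : A i → A i → ℝ) :
    Fintype.card (A i) * deviationProb i y = ∑ c, (1 - y c c) := by
  have hc : ∀ j, (Fintype.card (A j) : ℝ) ≠ 0 := fun j => by exact_mod_cast Fintype.card_ne_zero
  have hx : ∀ j, (fun _ _ => 1 / (Fintype.card (A j) : ℝ)) ∈ playerStrategies A j := by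
    intro j r
    exact ⟨fun _ => by positivity, by simp [hc j]⟩
  have h := sum_playProb_mul_coord hx (fun j => Classical.arbitrary _) i fun c => 1 - y c c
  have hp : ∀ r a : Profile A, playProb (fun j _ _ => 1 / (Fintype.card (A j) : ℝ)) r a
      = 1 / (Fintype.card (Profile A) : ℝ) := by
    intro r a
    simp [playProb, Fintype.card_pi]
  simp only [hp] at h
  rw [deviationProb, h, ← Finset.mul_sum, ← mul_assoc, mul_one_div_cancel (hc i), one_mul]

theorem maxActions_pos_of (hn : 0 < n) : 0 < maxActions A :=
  (Fintype.card_pos (α := A ⟨0, hn⟩)).trans_le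
    (Finset.le_sup (f := fun i => Fintype.card (A i)) (Finset.mem_univ _))

/-- Whatever the recommended profile is, the probability that someone deviates is controlled by
the deviation probabilities under uniform recommendations. -/
theorem one_sub_playProb_self_le {x : ∀ i, A i → A i → ℝ} (hx : ∀ i, x i ∈ playerStrategies A i)
    (r : Profile A) : 1 - playProb x r r ≤ maxActions A * ∑ i, deviationProb i (x i) := by
  refine (one_sub_prod_le _ _ (fun i => (hx i (r i)).1 (r i))
    fun i => le_one_of_mem (hx i) _ _).trans ?_
  rw [Finset.mul_sum]
  refine Finset.sum_le_sum fun i _ => ?_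
  -- Nothing is known about `r`, so one recommendation is bounded by the sum over all of them; this
  -- costs the factor `maxActions A`.
  have h1 : 1 - x i (r i) (r i) ≤ ∑ c, (1 - x i c c) :=
    Finset.single_le_sum (f := fun c => 1 - x i c c)
      (fun c _ => by linarith [le_one_of_mem (hx i) c c]) (Finset.mem_univ (r i))
  rw [← deviationProb_eq_card] at h1
  refine h1.trans (mul_le_mul_of_nonneg_right ?_ (deviationProb_nonneg (hx i)))
  exact_mod_cast Finset.le_sup (f := fun i => Fintype.card (A i)) (Finset.mem_univ i)

/-- A union bound over players. Summing over all `r` is a uniform average up to the number of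
profiles, so no factor `maxActions A` appears. -/
theorem sum_one_sub_playProb_self_le {x : ∀ i, A i → A i → ℝ}
    (hx : ∀ i, x i ∈ playerStrategies A i) :
    ∑ r, (1 - playProb x r r) ≤ Fintype.card (Profile A) * ∑ i, deviationProb i (x i) := by
  have hm : (Fintype.card (Profile A) : ℝ) ≠ 0 := by exact_mod_cast Fintype.card_ne_zero
  rw [Finset.mul_sum]
  calc ∑ r, (1 - playProb x r r) ≤ ∑ r : Profile A, ∑ i, (1 - x i (r i) (r i)) :=
        Finset.sum_le_sum fun r _ => one_sub_prod_le _ _ (fun i => (hx i (r i)).1 (r i))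
          fun i => le_one_of_mem (hx i) _ _
    _ = _ := by
        rw [Finset.sum_comm]
        refine Finset.sum_congr rfl fun i _ => ?_
        rw [deviationProb, ← Finset.mul_sum, ← mul_assoc, mul_one_div_cancel hm, one_mul]

end Strategies

/-! ### Expected utilities, payments and objective values in one round. -/

section Rounds

variable {n : ℕ} {A : Fin n → Type v} [∀ i, Fintype (A i)] [∀ i, DecidableEq (A i)]

theorem expect_eq (α : ℝ) (μ : Profile A → ℝ) (x : ∀ i, A i → A i → ℝ) (f : Outcome A → ℝ) :
    expect α μ x f
      = α * ∑ d, μ d * ∑ r, 1 / (Fintype.card (Profile A) : ℝ)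
          * ∑ a, playProb x r a * f (true, d, r, a)
        + (1 - α) * ∑ d, μ d * ∑ a, playProb x d a * f (false, d, d, a) := by
  unfold expect
  rw [Fintype.sum_prod_type, Fintype.sum_bool]
  simp only [Fintype.sum_prod_type, roundLaw, Finset.mul_sum]
  congr 1
  · refine Finset.sum_congr rfl fun d _ => Finset.sum_congr rfl fun r _ =>
      Finset.sum_congr rfl fun a _ => by ring
  · refine Finset.sum_congr rfl fun d _ => ?_
    rw [Finset.sum_eq_single d]
    · refine Finset.sum_congr rfl fun a _ => by rw [if_pos rfl]; ring
    · intro r _ hr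
      exact Finset.sum_eq_zero fun a _ => by rw [if_neg hr]; ring
    · simp

theorem value_nonneg {f μ : Profile A → ℝ} {x : ∀ i, A i → A i → ℝ}
    (hμ : μ ∈ mediatorStrategies A) (hx : ∀ i, x i ∈ playerStrategies A i)
    (hf : ∀ a, f a ∈ Set.Icc (0 : ℝ) 1) : 0 ≤ value f μ x :=
  Finset.sum_nonneg fun r _ => mul_nonneg (hμ.1 r) <| Finset.sum_nonneg fun a _ =>
    mul_nonneg (playProb_nonneg hx r a) (hf a).1

theorem sum_playProb_mul_le_one {f : Profile A → ℝ} {x : ∀ i, A i → A i → ℝ}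
    (hx : ∀ i, x i ∈ playerStrategies A i) (hf : ∀ a, f a ∈ Set.Icc (0 : ℝ) 1) (r : Profile A) :
    ∑ a, playProb x r a * f a ≤ 1 := by
  rw [← sum_playProb hx r]
  exact Finset.sum_le_sum fun a _ => mul_le_of_le_one_right (playProb_nonneg hx r a) (hf a).2

theorem value_le_one {f μ : Profile A → ℝ} {x : ∀ i, A i → A i → ℝ}
    (hμ : μ ∈ mediatorStrategies A) (hx : ∀ i, x i ∈ playerStrategies A i)
    (hf : ∀ a, f a ∈ Set.Icc (0 : ℝ) 1) : value f μ x ≤ 1 := by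
  rw [← hμ.2]
  exact Finset.sum_le_sum fun r _ =>
    mul_le_of_le_one_right (hμ.1 r) (sum_playProb_mul_le_one hx hf r)

theorem sum_mul_le_of_le {μ g : Profile A → ℝ} (hμ : μ ∈ mediatorStrategies A) {c : ℝ}
    (hg : ∀ r, g r ≤ c) : ∑ r, μ r * g r ≤ c := by
  calc ∑ r, μ r * g r ≤ ∑ r, μ r * c :=
        Finset.sum_le_sum fun r _ => mul_le_mul_of_nonneg_left (hg r) (hμ.1 r)
    _ = c := by rw [← Finset.sum_mul, hμ.2, one_mul]

namespace Game

variable (G : Game A)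

theorem devGain_eq (μ : Profile A → ℝ) {i : Fin n} {y : A i → A i → ℝ}
    (hy : y ∈ playerStrategies A i) :
    G.devGain μ i y
      = ∑ r, μ r * ((∑ c, y (r i) c * G.u i (Function.update r i c)) - G.u i r) := by
  simp only [devGain, value_update_direct _ _ hy, value_direct, mul_sub, Finset.sum_sub_distrib]

theorem devGain_direct (μ : Profile A → ℝ) (i : Fin n) : G.devGain μ i (direct A i) = 0 := by
  simp [devGain]

theorem devGain_convexCombination_direct (μ : Profile A → ℝ) {i : Fin n} {y : A i → A i → ℝ}
    (hy : y ∈ playerStrategies A i) {s : ℝ} (h0 : 0 ≤ s) (h1 : s ≤ 1) :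
    G.devGain μ i (fun r a => (1 - s) * direct A i r a + s * y r a) = s * G.devGain μ i y := by
  rw [G.devGain_eq μ (convexCombination_mem (direct_mem i) hy h0 h1), G.devGain_eq μ hy,
    Finset.mul_sum]
  refine Finset.sum_congr rfl fun r _ => ?_
  have h : ∀ c, ((1 - s) * direct A i (r i) c + s * y (r i) c) * G.u i (Function.update r i c)
      = (1 - s) * (direct A i (r i) c * G.u i (Function.update r i c))
        + s * (y (r i) c * G.u i (Function.update r i c)) := fun c => by ring
  have hd : ∑ c, direct A i (r i) c * G.u i (Function.update r i c) = G.u i r := by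
    simp [direct]
  simp only [h, Finset.sum_add_distrib, ← Finset.mul_sum, hd]
  ring

/-- The reward depends on the played profile only through one coordinate at a time, so even under
joint deviations its mean involves only unilateral deviation gains. -/
theorem mediatorUtility_eq (α lam : ℝ) {x : ∀ i, A i → A i → ℝ}
    (hx : ∀ i, x i ∈ playerStrategies A i) (ν : Profile A → ℝ) :
    G.mediatorUtility α lam x ν
      = (1 - α) * (1 / lam * value G.u0 ν (direct A) - ∑ i, G.devGain ν i (x i)) := by
  have hin : ∀ r : Profile A, ∑ a, playProb x r a * G.mediatorReward lam (false, r, r, a)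
      = 1 / lam * G.u0 r
        - ∑ i, ((∑ c, x i (r i) c * G.u i (Function.update r i c)) - G.u i r) := by
    intro r
    simp only [mediatorReward, mul_sub, Finset.sum_sub_distrib, ← Finset.sum_mul,
      sum_playProb hx, one_mul]
    congr 2
    simp only [Finset.mul_sum]
    rw [Finset.sum_comm]
    exact Finset.sum_congr rfl fun i _ =>
      sum_playProb_mul_coord hx r i fun c => G.u i (Function.update r i c)
  unfold mediatorUtility
  rw [expect_eq]
  simp only [hin, G.devGain_eq ν (hx _), value_direct]
  simp only [mediatorReward, mul_zero, Finset.sum_const_zero, zero_add]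
  congr 1
  rw [Finset.sum_comm, Finset.mul_sum, ← Finset.sum_sub_distrib]
  refine Finset.sum_congr rfl fun r _ => ?_
  rw [← Finset.mul_sum]
  ring

variable [∀ i, Nonempty (A i)]

/-- The part of a payment that the paid player cannot influence. -/
noncomputable def paymentOffset (i : Fin n) (r a : Profile A) : ℝ :=
  Finset.univ.inf' Finset.univ_nonempty fun a' : A i =>
    G.u i (Function.update r i a') - G.u i (Function.update a i a')

/-- In both kinds of round the payment cancels the true utility `G.u i a`. Exploration leaves `1`
plus the indicator of obedience; a normal round leaves the utility against direct opponents minus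
`paymentOffset`, whose mean does not depend on `y`. -/
theorem playerUtility_eq (α : ℝ) {μ : Profile A → ℝ} (hμ : μ ∈ mediatorStrategies A)
    {x : ∀ i, A i → A i → ℝ} (hx : ∀ i, x i ∈ playerStrategies A i) {i : Fin n}
    {y : A i → A i → ℝ} (hy : y ∈ playerStrategies A i) :
    G.playerUtility α μ x i y
      = α * (2 - deviationProb i y) + (1 - α) * (G.devGain μ i y + ∑ r, μ r * G.u i r
          - ∑ r, μ r * ∑ a, playProb x r a * G.paymentOffset i r a) := by
  have hxy := update_mem hx hy
  have htrue : ∀ r : Profile A, ∑ a, playProb (Function.update x i y) r a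
      * (G.u i a + (1 - G.u i a + (if a i = r i then 1 else 0))) = 1 + y (r i) (r i) := by
    intro r
    have h := sum_playProb_mul_coord hxy r i fun c => if c = r i then 1 else 0
    simp only [Function.update_self, mul_ite, mul_one, mul_zero, Finset.sum_ite_eq',
      Finset.mem_univ, if_true] at h
    refine Eq.trans ?_ (congrArg₂ (· + ·) (sum_playProb hxy r) h)
    rw [← Finset.sum_add_distrib]
    refine Finset.sum_congr rfl fun a _ => ?_
    split_ifs <;> ring
  have hfalse : ∀ r : Profile A, ∑ a, playProb (Function.update x i y) r a
      * (G.u i a + (G.u i (Function.update r i (a i)) - G.u i a - G.paymentOffset i r a))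
      = ∑ c, y (r i) c * G.u i (Function.update r i c)
        - ∑ a, playProb x r a * G.paymentOffset i r a := by
    intro r
    have h := sum_playProb_mul_coord hxy r i fun c => G.u i (Function.update r i c)
    rw [Function.update_self] at h
    rw [← h, ← sum_playProb_update_eq hx hy r (k := G.paymentOffset i r)
      (fun a c => by simp [paymentOffset]), ← Finset.sum_sub_distrib]
    refine Finset.sum_congr rfl fun a _ => by ring
  unfold playerUtility
  rw [expect_eq]
  simp only [played, payment]
  simp only [paymentOffset] at hfalse
  simp only [htrue, hfalse, G.devGain_eq μ hy, paymentOffset]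
  congr 1
  · congr 1
    rw [← Finset.sum_mul, hμ.2, one_mul, deviationProb, eq_sub_iff_add_eq,
      ← Finset.sum_add_distrib]
    refine Eq.trans ?_ ((congrArg (2 * ·) (sum_uniform (A := A))).trans (mul_one 2))
    simp only [Finset.mul_sum]
    refine Finset.sum_congr rfl fun r _ => by ring
  · congr 1
    simp only [mul_sub, Finset.sum_sub_distrib]
    ring

theorem playerUtility_sub (α : ℝ) {μ : Profile A → ℝ} (hμ : μ ∈ mediatorStrategies A)
    {x : ∀ i, A i → A i → ℝ} (hx : ∀ i, x i ∈ playerStrategies A i) {i : Fin n}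
    {y : A i → A i → ℝ} (hy : y ∈ playerStrategies A i) :
    G.playerUtility α μ x i y - G.playerUtility α μ x i (x i)
      = α * (deviationProb i (x i) - deviationProb i y)
        + (1 - α) * (G.devGain μ i y - G.devGain μ i (x i)) := by
  rw [G.playerUtility_eq α hμ hx hy, G.playerUtility_eq α hμ hx (hx i)]
  ring

theorem payment_le_two (i : Fin n) (o : Outcome A) : G.payment i o ≤ 2 := by
  obtain ⟨_ | _, d, r, a⟩ := o
  · have h : -1 ≤ G.paymentOffset i r a := by
      refine Finset.le_inf' _ _ fun a' _ => ?_
      linarith [(G.u_mem i (Function.update r i a')).1, (G.u_mem i (Function.update a i a')).2]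
    have := (G.u_mem i (Function.update r i (a i))).2
    have := (G.u_mem i a).1
    simp only [payment]
    unfold paymentOffset at h
    linarith
  · have := (G.u_mem i a).1
    simp only [payment]
    split_ifs <;> linarith

theorem payment_eq_zero (i : Fin n) (d r : Profile A) : G.payment i (false, d, r, r) = 0 := by
  simp [payment]

/-- Outside exploration nothing is paid when everyone obeys, and at most 2 otherwise, so the payment
is at most twice the probability of disobedience. -/
theorem expect_payment_le {α : ℝ} (h0 : 0 ≤ α) (h1 : α ≤ 1) {μ : Profile A → ℝ}
    (hμ : μ ∈ mediatorStrategies A) {x : ∀ i, A i → A i → ℝ}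
    (hx : ∀ i, x i ∈ playerStrategies A i) (i : Fin n) :
    expect α μ x (G.payment i)
      ≤ 2 * α + 2 * (maxActions A * ∑ j, deviationProb j (x j)) := by
  have hD : 0 ≤ maxActions A * ∑ j, deviationProb j (x j) :=
    mul_nonneg (by positivity) (Finset.sum_nonneg fun j _ => deviationProb_nonneg (hx j))
  rw [expect_eq]
  refine add_le_add ?_ ?_
  · rw [mul_comm 2 α]
    refine mul_le_mul_of_nonneg_left (sum_mul_le_of_le hμ fun d => ?_) h0
    refine sum_mul_le_of_le uniform_mem fun r => ?_
    calc ∑ a, playProb x r a * G.payment i (true, d, r, a) ≤ ∑ a, playProb x r a * 2 :=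
          Finset.sum_le_sum fun a _ =>
            mul_le_mul_of_nonneg_left (G.payment_le_two i _) (playProb_nonneg hx r a)
      _ = 2 := by rw [← Finset.sum_mul, sum_playProb hx, one_mul]
  · have hs : ∑ d, μ d * ∑ a, playProb x d a * G.payment i (false, d, d, a)
        ≤ 2 * (maxActions A * ∑ j, deviationProb j (x j)) := by
      refine sum_mul_le_of_le hμ fun d => ?_
      calc ∑ a, playProb x d a * G.payment i (false, d, d, a)
          ≤ ∑ a, (playProb x d a * 2 - if a = d then playProb x d a * 2 else 0) := by
            refine Finset.sum_le_sum fun a _ => ?_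
            split_ifs with h
            · simp [h, payment_eq_zero]
            · rw [sub_zero]
              exact mul_le_mul_of_nonneg_left (G.payment_le_two i _) (playProb_nonneg hx d a)
        _ = 2 * (1 - playProb x d d) := by
            rw [Finset.sum_sub_distrib, ← Finset.sum_mul, sum_playProb hx]
            simp only [Finset.sum_ite_eq', Finset.mem_univ, if_true]
            ring
        _ ≤ _ := mul_le_mul_of_nonneg_left (one_sub_playProb_self_le hx d) zero_le_two
    nlinarith

end Game

variable [∀ i, Nonempty (A i)]

theorem value_direct_sub_value_le {f μ : Profile A → ℝ} (hμ : μ ∈ mediatorStrategies A)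
    {x : ∀ i, A i → A i → ℝ} (hx : ∀ i, x i ∈ playerStrategies A i)
    (hf : ∀ a, f a ∈ Set.Icc (0 : ℝ) 1) :
    value f μ (direct A) - value f μ x ≤ maxActions A * ∑ i, deviationProb i (x i) := by
  rw [value_direct, value, ← Finset.sum_sub_distrib]
  simp only [← mul_sub]
  refine sum_mul_le_of_le hμ fun r => le_trans ?_ (one_sub_playProb_self_le hx r)
  have h : playProb x r r * f r ≤ ∑ a, playProb x r a * f a :=
    Finset.single_le_sum (f := fun a => playProb x r a * f a)
      (fun a _ => mul_nonneg (playProb_nonneg hx r a) (hf a).1) (Finset.mem_univ r)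
  nlinarith [(hf r).2, playProb_le_one hx r r]

theorem value_explored (α : ℝ) (f μ : Profile A → ℝ) (x : ∀ i, A i → A i → ℝ) :
    value f (explored α μ) x
      = (1 - α) * value f μ x
        + α * value f (fun _ => 1 / (Fintype.card (Profile A) : ℝ)) x := by
  simp only [value, explored, Finset.mul_sum, ← Finset.sum_add_distrib]
  refine Finset.sum_congr rfl fun r _ => Finset.sum_congr rfl fun a _ => by ring

theorem value_sub_value_explored_le {α : ℝ} (h0 : 0 ≤ α) {f μ : Profile A → ℝ}
    (hμ : μ ∈ mediatorStrategies A) {x : ∀ i, A i → A i → ℝ}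
    (hx : ∀ i, x i ∈ playerStrategies A i) (hf : ∀ a, f a ∈ Set.Icc (0 : ℝ) 1) :
    value f μ x - value f (explored α μ) x ≤ α := by
  rw [value_explored]
  nlinarith [value_le_one hμ hx hf, value_nonneg (uniform_mem (A := A)) hx hf]

/-- Realized play includes the exploration rounds, so its mean is governed by `explored α μ` rather
than by `μ`. -/
theorem expect_played (α : ℝ) (f : Profile A → ℝ) {μ : Profile A → ℝ}
    (hμ : μ ∈ mediatorStrategies A) (x : ∀ i, A i → A i → ℝ) :
    expect α μ x (fun o => f (played o)) = value f (explored α μ) x := by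
  rw [expect_eq, value_explored]
  simp only [played, ← Finset.sum_mul, hμ.2, one_mul, value]
  ring

/-- The `ℓ¹` distance from a distribution to a point mass is twice the mass missing at that point.
-/
theorem sum_abs_playProb_sub {x : ∀ i, A i → A i → ℝ} (hx : ∀ i, x i ∈ playerStrategies A i)
    (r : Profile A) :
    ∑ a, |playProb x r a - playProb (direct A) r a| = 2 * (1 - playProb x r r) := by
  have h : ∀ a, |playProb x r a - playProb (direct A) r a|
      = playProb x r a + if a = r then 1 - 2 * playProb x r a else 0 := by
    intro a
    rw [playProb_direct]
    split_ifs
    · rw [abs_of_nonpos (by linarith [playProb_le_one hx r a])]; ring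
    · rw [sub_zero, add_zero, abs_of_nonneg (playProb_nonneg hx r a)]
  simp only [h, Finset.sum_add_distrib, sum_playProb hx, Finset.sum_ite_eq', Finset.mem_univ,
    if_true]
  ring

end Rounds

/-! ### Max-min solutions of the Lagrangian and what exactness gives. -/

section Multiplier

variable {n : ℕ} {A : Fin n → Type v} [∀ i, Fintype (A i)] [∀ i, DecidableEq (A i)]

theorem isCompact_playerStrategies (i : Fin n) : IsCompact (playerStrategies A i) := by
  have h : playerStrategies A i = Set.univ.pi fun _ => stdSimplex ℝ (A i) := by
    ext y; simp [playerStrategies]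
  rw [h]
  exact isCompact_univ_pi fun _ => isCompact_stdSimplex ℝ (A i)

theorem isCompact_strategyProfiles :
    IsCompact {x : ∀ i, A i → A i → ℝ | ∀ i, x i ∈ playerStrategies A i} := by
  have h : {x : ∀ i, A i → A i → ℝ | ∀ i, x i ∈ playerStrategies A i}
      = Set.univ.pi fun i => playerStrategies A i := by
    ext y; simp
  rw [h]
  exact isCompact_univ_pi fun i => isCompact_playerStrategies i

theorem strategyProfiles_nonempty :
    {x : ∀ i, A i → A i → ℝ | ∀ i, x i ∈ playerStrategies A i}.Nonempty :=
  ⟨direct A, direct_mem⟩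

theorem continuous_playProb (r a : Profile A) :
    Continuous fun x : ∀ i, A i → A i → ℝ => playProb x r a := by
  unfold playProb
  fun_prop

theorem continuous_value (f : Profile A → ℝ) :
    Continuous fun p : (Profile A → ℝ) × (∀ i, A i → A i → ℝ) => value f p.1 p.2 := by
  unfold value playProb
  fun_prop

namespace Game

variable (G : Game A)

theorem continuous_lagrangian (lam : ℝ) :
    Continuous fun p : (Profile A → ℝ) × (∀ i, A i → A i → ℝ) => G.lagrangian lam p.1 p.2 := by
  have h0 : Continuous fun p : (Profile A → ℝ) × (∀ i, A i → A i → ℝ) =>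
      value G.u0 p.1 (direct A) :=
    (continuous_value G.u0).comp (continuous_fst.prodMk continuous_const)
  have h1 : ∀ i, Continuous fun p : (Profile A → ℝ) × (∀ i, A i → A i → ℝ) =>
      value (G.u i) p.1 (direct A) := fun i =>
    (continuous_value (G.u i)).comp (continuous_fst.prodMk continuous_const)
  have h2 : ∀ i, Continuous fun p : (Profile A → ℝ) × (∀ i, A i → A i → ℝ) =>
      value (G.u i) p.1 (Function.update (direct A) i (p.2 i)) := fun i =>
    (continuous_value (G.u i)).comp (continuous_fst.prodMk
      (continuous_const.update i ((continuous_apply i).comp continuous_snd)))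
  unfold lagrangian devGain
  exact h0.sub (continuous_const.mul (continuous_finsetSum _ fun i _ => (h2 i).sub (h1 i)))

theorem bddBelow_lagrangian (lam : ℝ) (μ : Profile A → ℝ) :
    BddBelow (G.lagrangian lam μ '' {x | ∀ i, x i ∈ playerStrategies A i}) :=
  (isCompact_strategyProfiles.image
    ((G.continuous_lagrangian lam).comp (Continuous.prodMk_right μ))).bddBelow

theorem exists_lagrangian_eq_worstValue (lam : ℝ) (μ : Profile A → ℝ) :
    ∃ x : ∀ i, A i → A i → ℝ, (∀ i, x i ∈ playerStrategies A i) ∧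
      G.worstValue lam μ = G.lagrangian lam μ x :=
  isCompact_strategyProfiles.exists_sInf_image_eq strategyProfiles_nonempty
    ((G.continuous_lagrangian lam).comp (Continuous.prodMk_right μ)).continuousOn

/-- An infimum of continuous functions is upper semicontinuous, which is enough for a maximum on the
compact simplex to exist. -/
theorem upperSemicontinuous_worstValue (lam : ℝ) : UpperSemicontinuous (G.worstValue lam) := by
  intro μ c hc
  obtain ⟨x, hx, hxe⟩ := G.exists_lagrangian_eq_worstValue lam μ
  rw [hxe] at hc
  have hcont : Continuous fun ν => G.lagrangian lam ν x :=
    (G.continuous_lagrangian lam).comp (Continuous.prodMk_left x)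
  filter_upwards [hcont.continuousAt.eventually_lt_const hc] with ν hν
  exact (csInf_le (G.bddBelow_lagrangian lam ν) ⟨x, hx, rfl⟩).trans_lt hν

theorem worstValue_le_direct (lam : ℝ) (μ : Profile A → ℝ) :
    G.worstValue lam μ ≤ value G.u0 μ (direct A) := by
  refine (csInf_le (G.bddBelow_lagrangian lam μ) ⟨direct A, direct_mem, rfl⟩).trans_eq ?_
  simp [lagrangian, devGain_direct]

variable [∀ i, Nonempty (A i)]

theorem exists_isMaxMin (lam : ℝ) : ∃ μ, G.IsMaxMin lam μ :=
  ((G.upperSemicontinuous_worstValue lam).upperSemicontinuousOn _).exists_isMaxOn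
    ⟨_, uniform_mem⟩ (isCompact_stdSimplex ℝ (Profile A))

variable {G}

theorem IsExactMultiplier.exists_isOptimalEquilibrium {lamStar : ℝ}
    (h : G.IsExactMultiplier lamStar) : ∃ μ, G.IsOptimalEquilibrium μ := by
  obtain ⟨μ, hμ⟩ := G.exists_isMaxMin lamStar
  exact ⟨μ, (h.2 lamStar le_rfl μ).1 hμ⟩

/-- Against an exact multiplier, no mediator strategy beats the optimal equilibria. -/
theorem IsExactMultiplier.exists_lagrangian_le {lamStar : ℝ} (h : G.IsExactMultiplier lamStar)
    {μStar : Profile A → ℝ} (hμStar : G.IsOptimalEquilibrium μStar) {μ : Profile A → ℝ}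
    (hμ : μ ∈ mediatorStrategies A) :
    ∃ x : ∀ i, A i → A i → ℝ, (∀ i, x i ∈ playerStrategies A i) ∧
      G.lagrangian lamStar μ x ≤ value G.u0 μStar (direct A) := by
  obtain ⟨x, hx, hxe⟩ := G.exists_lagrangian_eq_worstValue lamStar μ
  refine ⟨x, hx, hxe ▸ ?_⟩
  -- `μStar` is a max-min solution, and direct play is one of the responses in its own minimum.
  exact (((h.2 lamStar le_rfl μStar).2 hμStar).2 μ hμ).trans (G.worstValue_le_direct _ _)

end Game

end Multiplier

/-! ### Time averages and the certificate obtained from the regrets. -/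

section Averages

variable {n : ℕ} {A : Fin n → Type v} [∀ i, Fintype (A i)] [∀ i, DecidableEq (A i)]

/-- Time-averaged number of deviations under uniformly random recommendations. -/
noncomputable def averageDeviation (T : ℕ) (x : ℕ → ∀ i, A i → A i → ℝ) : ℝ :=
  1 / (T : ℝ) * ∑ t ∈ Finset.range T, ∑ i, deviationProb i (x t i)

/-- Time-averaged mediator strategy. -/
noncomputable def averageMediator (T : ℕ) (μ : ℕ → Profile A → ℝ) : Profile A → ℝ :=
  fun r => 1 / (T : ℝ) * ∑ t ∈ Finset.range T, μ t r

theorem average_le_of_le {T : ℕ} (hT : 0 < T) {g : ℕ → ℝ} {c : ℝ} (h : ∀ t < T, g t ≤ c) :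
    1 / (T : ℝ) * ∑ t ∈ Finset.range T, g t ≤ c := by
  have hT' : (0 : ℝ) < T := by exact_mod_cast hT
  have : ∑ t ∈ Finset.range T, g t ≤ ∑ _t ∈ Finset.range T, c :=
    Finset.sum_le_sum fun t ht => h t (Finset.mem_range.1 ht)
  rw [Finset.sum_const, Finset.card_range, nsmul_eq_mul] at this
  rw [one_div_mul_eq_div, div_le_iff₀ hT']
  linarith

theorem average_le_average (T : ℕ) {g h : ℕ → ℝ} (hgh : ∀ t < T, g t ≤ h t) :
    1 / (T : ℝ) * ∑ t ∈ Finset.range T, g t ≤ 1 / (T : ℝ) * ∑ t ∈ Finset.range T, h t :=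
  mul_le_mul_of_nonneg_left
    (Finset.sum_le_sum fun t ht => hgh t (Finset.mem_range.1 ht)) (by positivity)

theorem average_const {T : ℕ} (hT : 0 < T) (c : ℝ) :
    1 / (T : ℝ) * ∑ _t ∈ Finset.range T, c = c := by
  have hT' : (T : ℝ) ≠ 0 := by exact_mod_cast hT.ne'
  simp [hT']

theorem averageMediator_mem {T : ℕ} (hT : 0 < T) {μ : ℕ → Profile A → ℝ}
    (hμ : ∀ t < T, μ t ∈ mediatorStrategies A) : averageMediator T μ ∈ mediatorStrategies A := by
  refine ⟨fun r => mul_nonneg (by positivity)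
    (Finset.sum_nonneg fun t ht => (hμ t (Finset.mem_range.1 ht)).1 r), ?_⟩
  simp only [averageMediator]
  rw [← Finset.mul_sum, Finset.sum_comm, Finset.sum_congr rfl fun t ht =>
    (hμ t (Finset.mem_range.1 ht)).2, average_const hT]

theorem value_averageMediator (T : ℕ) (f : Profile A → ℝ) (μ : ℕ → Profile A → ℝ)
    (x : ∀ i, A i → A i → ℝ) :
    value f (averageMediator T μ) x = 1 / (T : ℝ) * ∑ t ∈ Finset.range T, value f (μ t) x := by
  simp only [value, averageMediator]
  rw [Finset.sum_comm (s := Finset.range T), Finset.mul_sum]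
  exact Finset.sum_congr rfl fun r _ => by rw [← Finset.sum_mul, mul_assoc]

variable [∀ i, Nonempty (A i)]

theorem directnessGap_le {T : ℕ} (hT : 0 < T) {x : ℕ → ∀ i, A i → A i → ℝ}
    (hx : ∀ t < T, ∀ i, x t i ∈ playerStrategies A i) :
    directnessGap T x ≤ 2 * Fintype.card (Profile A) * averageDeviation T x := by
  have h1 : ∀ z : Terminal A,
      |1 / (T : ℝ) * ∑ t ∈ Finset.range T, playProb (x t) z.1 z.2 - playProb (direct A) z.1 z.2|
      ≤ 1 / (T : ℝ) * ∑ t ∈ Finset.range T,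
        |playProb (x t) z.1 z.2 - playProb (direct A) z.1 z.2| := by
    intro z
    rw [← average_const hT (playProb (direct A) z.1 z.2), ← mul_sub, ← Finset.sum_sub_distrib,
      average_const hT, abs_mul, abs_of_nonneg (by positivity : (0 : ℝ) ≤ 1 / T)]
    exact mul_le_mul_of_nonneg_left (Finset.abs_sum_le_sum_abs _ _) (by positivity)
  refine (Finset.sum_le_sum fun z _ => h1 z).trans ?_
  rw [← Finset.mul_sum, Finset.sum_comm, averageDeviation, mul_left_comm]
  rw [Finset.mul_sum _ _ (2 * (Fintype.card (Profile A) : ℝ))]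
  refine average_le_average T fun t ht => ?_
  rw [Fintype.sum_prod_type, Finset.sum_congr rfl fun r _ => sum_abs_playProb_sub (hx t ht) r,
    ← Finset.mul_sum, mul_assoc]
  exact mul_le_mul_of_nonneg_left (sum_one_sub_playProb_self_le (hx t ht)) zero_le_two

theorem averageDeviation_le {T : ℕ} (hT : 0 < T) {x : ℕ → ∀ i, A i → A i → ℝ}
    (hx : ∀ t < T, ∀ i, x t i ∈ playerStrategies A i) : averageDeviation T x ≤ n := by
  refine average_le_of_le hT fun t ht => ?_
  calc ∑ i, deviationProb i (x t i) ≤ ∑ _i : Fin n, (1 : ℝ) :=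
        Finset.sum_le_sum fun i _ => deviationProb_le_one (hx t ht i)
    _ = n := by simp

namespace Game

variable (G : Game A)

theorem devGain_averageMediator (T : ℕ) (μ : ℕ → Profile A → ℝ) (i : Fin n)
    (y : A i → A i → ℝ) :
    G.devGain (averageMediator T μ) i y
      = 1 / (T : ℝ) * ∑ t ∈ Finset.range T, G.devGain (μ t) i y := by
  simp only [devGain, value_averageMediator, Finset.sum_sub_distrib, mul_sub]

theorem averagePayment_le {α : ℝ} (h0 : 0 ≤ α) (h1 : α ≤ 1) {T : ℕ} (hT : 0 < T)
    {μ : ℕ → Profile A → ℝ} (hμ : ∀ t < T, μ t ∈ mediatorStrategies A)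
    {x : ℕ → ∀ i, A i → A i → ℝ} (hx : ∀ t < T, ∀ i, x t i ∈ playerStrategies A i) (i : Fin n) :
    G.averagePayment α T μ x i ≤ 2 * α + 2 * (maxActions A * averageDeviation T x) := by
  have h := average_le_average T fun t ht => G.expect_payment_le h0 h1 (hμ t ht) (hx t ht) i
  rw [Finset.sum_add_distrib, mul_add, average_const hT, ← Finset.mul_sum, ← Finset.mul_sum] at h
  unfold averagePayment averageDeviation
  linarith

theorem optimalityGap_le {T : ℕ} {μ : ℕ → Profile A → ℝ}
    (hμ : ∀ t < T, μ t ∈ mediatorStrategies A) {x : ℕ → ∀ i, A i → A i → ℝ}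
    (hx : ∀ t < T, ∀ i, x t i ∈ playerStrategies A i) (μStar : Profile A → ℝ) :
    G.optimalityGap T μ x μStar
      ≤ value G.u0 μStar (direct A) - value G.u0 (averageMediator T μ) (direct A)
        + maxActions A * averageDeviation T x := by
  have h := average_le_average T fun t ht =>
    value_direct_sub_value_le (hμ t ht) (hx t ht) G.u0_mem
  rw [Finset.sum_sub_distrib, mul_sub, ← value_averageMediator, ← Finset.mul_sum] at h
  unfold optimalityGap averageDeviation
  linarith

theorem optimalityGap_explored_le {α : ℝ} (h0 : 0 ≤ α) {T : ℕ} (hT : 0 < T)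
    {μ : ℕ → Profile A → ℝ} (hμ : ∀ t < T, μ t ∈ mediatorStrategies A)
    {x : ℕ → ∀ i, A i → A i → ℝ} (hx : ∀ t < T, ∀ i, x t i ∈ playerStrategies A i)
    (μStar : Profile A → ℝ) :
    G.optimalityGap T (fun t => explored α (μ t)) x μStar ≤ G.optimalityGap T μ x μStar + α := by
  have h := average_le_of_le hT fun t ht =>
    value_sub_value_explored_le h0 (hμ t ht) (hx t ht) G.u0_mem
  rw [Finset.sum_sub_distrib, mul_sub] at h
  unfold optimalityGap
  linarith

/-- What the regrets certify, per round, about the mediator's strategy `M` and the number `δ`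
of deviations when the players are compared with `y`. -/
noncomputable def regretCertificate (α lam : ℝ) (μStar M : Profile A → ℝ) (δ : ℝ)
    (y : ∀ i, A i → A i → ℝ) : ℝ :=
  (1 - α) * (1 / lam * (value G.u0 μStar (direct A) - value G.u0 M (direct A))
    + ∑ i, G.devGain M i (y i)) + α * (δ - ∑ i, deviationProb i (y i))

variable {G}

/-- The gains `G.devGain μ i (x i)` occur with opposite signs in the mediator's and the players'
regrets and cancel. Only the gains at `μStar` are discarded, and they are nonpositive by
equilibrium. -/
theorem regretCertificate_le_round {α : ℝ} (h1 : α ≤ 1) (lam : ℝ) {μStar : Profile A → ℝ}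
    (hμStar : G.IsEquilibrium μStar) {μ : Profile A → ℝ} (hμ : μ ∈ mediatorStrategies A)
    {x y : ∀ i, A i → A i → ℝ} (hx : ∀ i, x i ∈ playerStrategies A i)
    (hy : ∀ i, y i ∈ playerStrategies A i) :
    G.regretCertificate α lam μStar μ (∑ i, deviationProb i (x i)) y
      ≤ (G.mediatorUtility α lam x μStar - G.mediatorUtility α lam x μ)
        + ∑ i, (G.playerUtility α μ x i (y i) - G.playerUtility α μ x i (x i)) := by
  have hle : ∑ i, G.devGain μStar i (x i) ≤ 0 :=
    Finset.sum_nonpos fun i _ => hμStar.2 i _ (hx i)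
  simp only [G.playerUtility_sub α hμ hx (hy _), G.mediatorUtility_eq α lam hx,
    regretCertificate, Finset.sum_add_distrib, ← Finset.mul_sum, Finset.sum_sub_distrib]
  nlinarith

theorem regretCertificate_le {α : ℝ} (h1 : α ≤ 1) (lam : ℝ) {μStar : Profile A → ℝ}
    (hμStar : G.IsEquilibrium μStar) {T : ℕ} (hT : 0 < T) {μ : ℕ → Profile A → ℝ}
    (hμ : ∀ t < T, μ t ∈ mediatorStrategies A) {x : ℕ → ∀ i, A i → A i → ℝ}
    (hx : ∀ t < T, ∀ i, x t i ∈ playerStrategies A i)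
    {y : ∀ i, A i → A i → ℝ} (hy : ∀ i, y i ∈ playerStrategies A i) :
    T * G.regretCertificate α lam μStar (averageMediator T μ) (averageDeviation T x) y
      ≤ (∑ t ∈ Finset.range T, G.mediatorUtility α lam (x t) μStar
          - ∑ t ∈ Finset.range T, G.mediatorUtility α lam (x t) (μ t))
        + ∑ i, 4 * (1 / (paymentBound + 1) *
          (∑ t ∈ Finset.range T, G.playerUtility α (μ t) (x t) i (y i)
            - ∑ t ∈ Finset.range T, G.playerUtility α (μ t) (x t) i (x t i))) := by
  have hT' : (T : ℝ) ≠ 0 := by exact_mod_cast hT.ne'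
  -- The factor 4 undoes the normalization of the players' regrets; it is the origin of `4nR(T)` in
  -- `ε`.
  have hP : ∀ c : ℝ, 4 * (1 / (paymentBound + 1) * c) = c := fun c => by
    rw [paymentBound]; ring
  have h := Finset.sum_le_sum fun t (ht : t ∈ Finset.range T) =>
    regretCertificate_le_round h1 lam hμStar (hμ t (Finset.mem_range.1 ht))
      (hx t (Finset.mem_range.1 ht)) hy
  refine le_trans (le_of_eq ?_) (h.trans (le_of_eq ?_))
  · simp only [regretCertificate, value_averageMediator, devGain_averageMediator,
      averageDeviation, Finset.sum_add_distrib, ← Finset.mul_sum, Finset.sum_sub_distrib,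
      Finset.sum_const, Finset.card_range, nsmul_eq_mul]
    rw [Finset.sum_comm (s := Finset.univ)]
    field_simp
  · simp only [hP, Finset.sum_add_distrib, Finset.sum_sub_distrib]
    rw [Finset.sum_comm (s := Finset.range T) (t := Finset.univ),
      Finset.sum_comm (s := Finset.range T) (t := Finset.univ)]

/-- A bound on the certificates for all comparators bounds the loss of the mediator. -/
theorem value_sub_le_of_regretCertificate_le {α lam ε : ℝ} (h0 : 0 ≤ α) (h1 : α ≤ 1 / 2)
    (hlam : 0 < lam) {μStar M : Profile A → ℝ} {δ : ℝ} (hδ : 0 ≤ δ)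
    (H : ∀ y : ∀ i, A i → A i → ℝ, (∀ i, y i ∈ playerStrategies A i) →
      G.regretCertificate α lam μStar M δ y ≤ ε) (hε : 0 ≤ ε) :
    value G.u0 μStar (direct A) - value G.u0 M (direct A) ≤ 2 * (ε * lam) := by
  -- Against direct play, all comparator terms vanish; `δ ≥ 0` is dropped and `1 - α ≥ 1/2` gives
  -- the factor 2.
  have h := H (direct A) direct_mem
  simp only [regretCertificate, devGain_direct, deviationProb_direct, Finset.sum_const_zero,
    add_zero, sub_zero] at h
  set c := value G.u0 μStar (direct A) - value G.u0 M (direct A)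
  by_contra! hc
  have h2 : 2 * ε < 1 / lam * c := by
    rw [one_div_mul_eq_div, lt_div_iff₀ hlam]; linarith
  nlinarith [mul_nonneg h0 hδ]

/-- A bound on the certificates for all comparators bounds the number of deviations. -/
theorem deviation_le_of_regretCertificate_le {α lam ε lamStar : ℝ} (h0 : 0 < α) (h1 : α ≤ 1)
    (hlam : 0 < lam) (hlamStar : G.IsExactMultiplier lamStar) (hle : lamStar ≤ lam)
    {μStar M : Profile A → ℝ} (hμStar : G.IsOptimalEquilibrium μStar)
    (hM : M ∈ mediatorStrategies A) {δ : ℝ}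
    (H : ∀ y : ∀ i, A i → A i → ℝ, (∀ i, y i ∈ playerStrategies A i) →
      G.regretCertificate α lam μStar M δ y ≤ ε) :
    δ ≤ ε / α + n * lamStar / lam := by
  obtain ⟨x, hx, hxle⟩ := hlamStar.exists_lagrangian_le hμStar hM
  have hs0 : 0 ≤ lamStar / lam := div_nonneg hlamStar.1 hlam.le
  have hs1 : lamStar / lam ≤ 1 := (div_le_one hlam).2 hle
  -- Gains and deviation probabilities scale linearly in the weight of `x`; the weight `lamStar /
  -- lam` turns the multiplier `lam` of the certificate into `lamStar`.
  have h := H (fun i r a => (1 - lamStar / lam) * direct A i r a + lamStar / lam * x i r a)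
    fun i => convexCombination_mem (direct_mem i) (hx i) hs0 hs1
  simp only [regretCertificate, deviationProb_convexCombination_direct,
    G.devGain_convexCombination_direct M (hx _) hs0 hs1, ← Finset.mul_sum] at h
  have hdev : ∑ i, deviationProb i (x i) ≤ n := by
    calc ∑ i, deviationProb i (x i) ≤ ∑ _i : Fin n, (1 : ℝ) :=
          Finset.sum_le_sum fun i _ => deviationProb_le_one (hx i)
      _ = n := by simp
  unfold lagrangian at hxle
  -- This is the bound on the Lagrangian at `lamStar`, divided by `lam`. It leaves only the `α` term
  -- of the certificate.
  have hgain : 0 ≤ 1 / lam * (value G.u0 μStar (direct A) - value G.u0 M (direct A))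
      + lamStar / lam * ∑ i, G.devGain M i (x i) := by
    have : 0 ≤ 1 / lam * (value G.u0 μStar (direct A) - value G.u0 M (direct A)
        + lamStar * ∑ i, G.devGain M i (x i)) :=
      mul_nonneg (by positivity) (by linarith)
    refine this.trans_eq (by ring)
  have h2 : α * (δ - lamStar / lam * ∑ i, deviationProb i (x i)) ≤ ε := by
    nlinarith [mul_nonneg (sub_nonneg.2 h1) hgain]
  have h3 : δ - lamStar / lam * ∑ i, deviationProb i (x i) ≤ ε / α := by
    rw [le_div_iff₀ h0]; linarith
  have h4 := mul_le_mul_of_nonneg_left hdev hs0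
  have h5 : n * lamStar / lam = lamStar / lam * n := by ring
  linarith

end Game

end Averages

/-! ### Random strategies: integrability, expected certificates, realized outcomes. -/

section RandomStrategies

variable {n : ℕ} {A : Fin n → Type v} [∀ i, Fintype (A i)] [∀ i, DecidableEq (A i)]
  {Ω : Type*} [mΩ : MeasurableSpace Ω]

/-- Random sequences of strategies of the mediator and of the players. -/
structure IsRandomPlay (T : ℕ) (μ : ℕ → Ω → Profile A → ℝ) (x : ℕ → Ω → ∀ i, A i → A i → ℝ) :
    Prop where
  med_mem : ∀ t < T, ∀ ω, μ t ω ∈ mediatorStrategies A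
  med_meas : ∀ t < T, ∀ r, Measurable fun ω => μ t ω r
  player_mem : ∀ t < T, ∀ ω i, x t ω i ∈ playerStrategies A i
  player_meas : ∀ t < T, ∀ i r a, Measurable fun ω => x t ω i r a

theorem IsRun.isRandomPlay {P : Measure Ω} {ℱ : Filtration ℕ mΩ} {α : ℝ} {T : ℕ}
    {μ : ℕ → Ω → Profile A → ℝ} {x : ℕ → Ω → ∀ i, A i → A i → ℝ} {o : ℕ → Ω → Outcome A}
    (h : IsRun P ℱ α T μ x o) : IsRandomPlay T μ x where
  med_mem := h.med_mem
  med_meas t ht r := (h.med_meas t ht r).mono (ℱ.le t) le_rfl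
  player_mem := h.player_mem
  player_meas t ht i r a := (h.player_meas t ht i r a).mono (ℱ.le t) le_rfl

theorem continuous_roundLaw (α : ℝ) (w : Outcome A) :
    Continuous fun p : (Profile A → ℝ) × (∀ i, A i → A i → ℝ) => roundLaw α p.1 p.2 w := by
  obtain ⟨_ | _, d, r, a⟩ := w
  all_goals
    simp only [roundLaw, playProb]
    fun_prop

theorem continuous_expect (α : ℝ) (f : Outcome A → ℝ) :
    Continuous fun p : (Profile A → ℝ) × (∀ i, A i → A i → ℝ) => expect α p.1 p.2 f :=
  continuous_finsetSum _ fun w _ => (continuous_roundLaw α w).mul continuous_const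

theorem continuous_deviationProb (i : Fin n) :
    Continuous fun y : A i → A i → ℝ => deviationProb i y := by
  unfold deviationProb
  fun_prop

namespace IsRandomPlay

variable {T : ℕ} {μ : ℕ → Ω → Profile A → ℝ} {x : ℕ → Ω → ∀ i, A i → A i → ℝ}

/-- The strategies lie in a compact set, on which continuous functions are bounded. -/
theorem integrable (h : IsRandomPlay T μ x) (P : Measure Ω) [IsFiniteMeasure P] {t : ℕ}
    (ht : t < T) {Φ : (Profile A → ℝ) × (∀ i, A i → A i → ℝ) → ℝ} (hΦ : Continuous Φ) :
    Integrable (fun ω => Φ (μ t ω, x t ω)) P := by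
  have hK : IsCompact (mediatorStrategies A ×ˢ
      {x : ∀ i, A i → A i → ℝ | ∀ i, x i ∈ playerStrategies A i}) :=
    (isCompact_stdSimplex ℝ (Profile A)).prod isCompact_strategyProfiles
  obtain ⟨C, hC⟩ := hK.exists_bound_of_continuousOn hΦ.continuousOn
  have hmeas : Measurable fun ω => (μ t ω, x t ω) :=
    (measurable_pi_iff.2 fun r => h.med_meas t ht r).prodMk
      (measurable_pi_iff.2 fun i => measurable_pi_iff.2 fun r => measurable_pi_iff.2 fun a =>
        h.player_meas t ht i r a)
  exact Integrable.of_bound (hΦ.measurable.comp hmeas).aestronglyMeasurable C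
    (Filter.Eventually.of_forall fun ω => hC _ ⟨h.med_mem t ht ω, h.player_mem t ht ω⟩)

theorem integrable_sum (h : IsRandomPlay T μ x) (P : Measure Ω) [IsFiniteMeasure P]
    {Φ : (Profile A → ℝ) × (∀ i, A i → A i → ℝ) → ℝ} (hΦ : Continuous Φ) :
    Integrable (fun ω => ∑ t ∈ Finset.range T, Φ (μ t ω, x t ω)) P :=
  integrable_finsetSum _ fun _ ht => h.integrable P (Finset.mem_range.1 ht) hΦ

theorem integrable_average (h : IsRandomPlay T μ x) (P : Measure Ω) [IsFiniteMeasure P]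
    {Φ : (Profile A → ℝ) × (∀ i, A i → A i → ℝ) → ℝ} (hΦ : Continuous Φ) :
    Integrable (fun ω => 1 / (T : ℝ) * ∑ t ∈ Finset.range T, Φ (μ t ω, x t ω)) P :=
  (h.integrable_sum P hΦ).const_mul _

theorem integrable_averageMediator (h : IsRandomPlay T μ x) (P : Measure Ω) [IsFiniteMeasure P]
    (r : Profile A) : Integrable (fun ω => averageMediator T (fun t => μ t ω) r) P :=
  h.integrable_average P (Φ := fun p => p.1 r) (by fun_prop)

theorem integrable_averageDeviation (h : IsRandomPlay T μ x) (P : Measure Ω)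
    [IsFiniteMeasure P] : Integrable (fun ω => averageDeviation T fun t => x t ω) P :=
  h.integrable_average P (Φ := fun p => ∑ i, deviationProb i (p.2 i))
    (continuous_finsetSum _ fun i _ =>
      (continuous_deviationProb i).comp ((continuous_apply i).comp continuous_snd))

theorem integrable_directnessGap (h : IsRandomPlay T μ x) (P : Measure Ω) [IsFiniteMeasure P] :
    Integrable (fun ω => directnessGap T fun t => x t ω) P :=
  integrable_finsetSum _ fun z _ => ((h.integrable_average P (Φ := fun p => playProb p.2 z.1 z.2)
    ((continuous_playProb _ _).comp continuous_snd)).sub (integrable_const _)).abs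

theorem integrable_mediatorRegret (h : IsRandomPlay T μ x) (P : Measure Ω) [IsFiniteMeasure P]
    (G : Game A) (α lam : ℝ) (ν : Profile A → ℝ) :
    Integrable (fun ω => ∑ t ∈ Finset.range T, G.mediatorUtility α lam (x t ω) ν
      - ∑ t ∈ Finset.range T, G.mediatorUtility α lam (x t ω) (μ t ω)) P :=
  (h.integrable_sum P (Φ := fun p => expect α ν p.2 (G.mediatorReward lam))
    ((continuous_expect α _).comp (continuous_const.prodMk continuous_snd))).sub
    (h.integrable_sum P (Φ := fun p => expect α p.1 p.2 (G.mediatorReward lam))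
      (continuous_expect α _))

theorem integrable_value (h : IsRandomPlay T μ x) (P : Measure Ω) [IsFiniteMeasure P]
    (f : Profile A → ℝ) (y : ∀ i, A i → A i → ℝ) :
    Integrable (fun ω => value f (averageMediator T fun t => μ t ω) y) P :=
  integrable_finsetSum _ fun r _ => (h.integrable_averageMediator P r).mul_const _

theorem integral_value (h : IsRandomPlay T μ x) (P : Measure Ω) [IsFiniteMeasure P]
    (f : Profile A → ℝ) (y : ∀ i, A i → A i → ℝ) :
    ∫ ω, value f (averageMediator T fun t => μ t ω) y ∂P
      = value f (fun r => ∫ ω, averageMediator T (fun t => μ t ω) r ∂P) y := by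
  unfold value
  rw [integral_finsetSum _ fun r _ => (h.integrable_averageMediator P r).mul_const _]
  exact Finset.sum_congr rfl fun r _ => integral_mul_const _ _

theorem integral_averageMediator_mem (h : IsRandomPlay T μ x) (P : Measure Ω)
    [IsProbabilityMeasure P] (hT : 0 < T) :
    (fun r => ∫ ω, averageMediator T (fun t => μ t ω) r ∂P) ∈ mediatorStrategies A := by
  have hmem : ∀ ω, averageMediator T (fun t => μ t ω) ∈ mediatorStrategies A :=
    fun ω => averageMediator_mem hT fun t ht => h.med_mem t ht ω
  refine ⟨fun r => integral_nonneg fun ω => (hmem ω).1 r, ?_⟩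
  rw [← integral_finsetSum _ fun r _ => h.integrable_averageMediator P r]
  simp [fun ω => (hmem ω).2]

theorem averageDeviation_nonneg (h : IsRandomPlay T μ x) (ω : Ω) :
    0 ≤ averageDeviation T fun t => x t ω :=
  mul_nonneg (by positivity) <| Finset.sum_nonneg fun t ht => Finset.sum_nonneg fun i _ =>
    deviationProb_nonneg (h.player_mem t (Finset.mem_range.1 ht) ω i)

variable [∀ i, Nonempty (A i)]

theorem integrable_playerRegret (h : IsRandomPlay T μ x) (P : Measure Ω) [IsFiniteMeasure P]
    (G : Game A) (α : ℝ) (i : Fin n) (y : A i → A i → ℝ) :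
    Integrable (fun ω => 1 / (Game.paymentBound + 1) *
      (∑ t ∈ Finset.range T, G.playerUtility α (μ t ω) (x t ω) i y
        - ∑ t ∈ Finset.range T, G.playerUtility α (μ t ω) (x t ω) i (x t ω i))) P :=
  ((h.integrable_sum P
    (Φ := fun p => expect α p.1 (Function.update p.2 i y) fun o => G.u i (played o) + G.payment i o)
    ((continuous_expect α _).comp (continuous_fst.prodMk
      (continuous_snd.update i continuous_const)))).sub
    (h.integrable_sum P
      (Φ := fun p => expect α p.1 (Function.update p.2 i (p.2 i))
        fun o => G.u i (played o) + G.payment i o)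
      ((continuous_expect α _).comp (continuous_fst.prodMk
        (continuous_snd.update i ((continuous_apply i).comp continuous_snd)))))).const_mul _

theorem integrable_averagePayment (h : IsRandomPlay T μ x) (P : Measure Ω) [IsFiniteMeasure P]
    (G : Game A) (α : ℝ) (i : Fin n) :
    Integrable (fun ω => G.averagePayment α T (fun t => μ t ω) (fun t => x t ω) i) P :=
  h.integrable_average P (Φ := fun p => expect α p.1 p.2 (G.payment i)) (continuous_expect α _)

theorem integrable_optimalityGap (h : IsRandomPlay T μ x) (P : Measure Ω) [IsFiniteMeasure P]
    (G : Game A) (μStar : Profile A → ℝ) :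
    Integrable (fun ω => G.optimalityGap T (fun t => μ t ω) (fun t => x t ω) μStar) P :=
  (integrable_const _).sub
    (h.integrable_average P (Φ := fun p => value G.u0 p.1 p.2) (continuous_value _))

theorem integrable_optimalityGap_explored (h : IsRandomPlay T μ x) (P : Measure Ω)
    [IsFiniteMeasure P] (G : Game A) (α : ℝ) (μStar : Profile A → ℝ) :
    Integrable (fun ω => G.optimalityGap T (fun t => explored α (μ t ω)) (fun t => x t ω) μStar)
      P := by
  have hc : Continuous fun p : (Profile A → ℝ) × (∀ i, A i → A i → ℝ) => explored α p.1 := by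
    unfold explored
    fun_prop
  exact (integrable_const _).sub (h.integrable_average P
    (Φ := fun p => value G.u0 (explored α p.1) p.2)
    ((continuous_value G.u0).comp (hc.prodMk continuous_snd)))

/-- The certificate is affine in the mediator strategy and in the deviation count. Comparators can
thus be chosen after taking expectations, and are not random. -/
theorem integral_regretCertificate (h : IsRandomPlay T μ x) (P : Measure Ω)
    [IsProbabilityMeasure P] (G : Game A) (α lam : ℝ) (μStar : Profile A → ℝ)
    (y : ∀ i, A i → A i → ℝ) :
    Integrable (fun ω => G.regretCertificate α lam μStar (averageMediator T fun t => μ t ω)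
        (averageDeviation T fun t => x t ω) y) P ∧
      ∫ ω, G.regretCertificate α lam μStar (averageMediator T fun t => μ t ω)
        (averageDeviation T fun t => x t ω) y ∂P
      = G.regretCertificate α lam μStar
        (fun r => ∫ ω, averageMediator T (fun t => μ t ω) r ∂P)
        (∫ ω, averageDeviation T (fun t => x t ω) ∂P) y := by
  have hg : ∀ i, Integrable (fun ω => G.devGain (averageMediator T fun t => μ t ω) i (y i)) P :=
    fun i => (h.integrable_value P _ _).sub (h.integrable_value P _ _)
  have hgs := integrable_finsetSum Finset.univ fun i _ => hg i
  have h0 := ((integrable_const (value G.u0 μStar (direct A))).sub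
    (h.integrable_value P G.u0 (direct A))).const_mul (1 / lam)
  have hd := (h.integrable_averageDeviation P).sub
    (integrable_const (∑ i, deviationProb i (y i)))
  refine ⟨((h0.add hgs).const_mul _).add (hd.const_mul _), ?_⟩
  unfold Game.regretCertificate
  refine (integral_add ((h0.add hgs).const_mul _) (hd.const_mul _)).trans ?_
  rw [integral_const_mul, integral_const_mul]
  congr 2
  · refine (integral_add h0 hgs).trans ?_
    rw [integral_const_mul, integral_finsetSum _ fun i _ => hg i]
    congr 2
    · refine (integral_sub (integrable_const _) (h.integrable_value P G.u0 (direct A))).trans ?_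
      rw [h.integral_value P]
      simp
    · funext i
      unfold Game.devGain
      refine (integral_sub (h.integrable_value P _ _) (h.integrable_value P _ _)).trans ?_
      rw [h.integral_value P, h.integral_value P]
  · refine (integral_sub (h.integrable_averageDeviation P) (integrable_const _)).trans ?_
    simp

/-- Expected regret bounds bound the certificate of the expected average strategies. -/
theorem regretCertificate_le (h : IsRandomPlay T μ x) (P : Measure Ω) [IsProbabilityMeasure P]
    (hT : 0 < T) {G : Game A} {α lam ρ₀ ρ : ℝ} (h1 : α ≤ 1)
    (h_med : ∀ ν ∈ mediatorStrategies A,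
      ∫ ω, (∑ t ∈ Finset.range T, G.mediatorUtility α lam (x t ω) ν
        - ∑ t ∈ Finset.range T, G.mediatorUtility α lam (x t ω) (μ t ω)) ∂P ≤ ρ₀)
    (h_player : ∀ i, ∀ y ∈ playerStrategies A i,
      ∫ ω, 1 / (Game.paymentBound + 1) *
        (∑ t ∈ Finset.range T, G.playerUtility α (μ t ω) (x t ω) i y
        - ∑ t ∈ Finset.range T, G.playerUtility α (μ t ω) (x t ω) i (x t ω i)) ∂P ≤ ρ)
    {μStar : Profile A → ℝ} (hμStar : G.IsEquilibrium μStar) {y : ∀ i, A i → A i → ℝ}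
    (hy : ∀ i, y i ∈ playerStrategies A i) :
    G.regretCertificate α lam μStar
        (fun r => ∫ ω, averageMediator T (fun t => μ t ω) r ∂P)
        (∫ ω, averageDeviation T (fun t => x t ω) ∂P) y ≤ (ρ₀ + 4 * n * ρ) / T := by
  have hT' : (0 : ℝ) < T := by exact_mod_cast hT
  obtain ⟨hint, heq⟩ := h.integral_regretCertificate P G α lam μStar y
  rw [← heq, le_div_iff₀' hT', ← integral_const_mul]
  have hp := fun i => (h.integrable_playerRegret P G α i (y i)).const_mul 4
  have hps := integrable_finsetSum Finset.univ fun i _ => hp i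
  have hm := h.integrable_mediatorRegret P G α lam μStar
  refine (integral_mono (hint.const_mul _) (hm.add hps) fun ω =>
    Game.regretCertificate_le h1 lam hμStar hT (fun t ht => h.med_mem t ht ω)
      (fun t ht => h.player_mem t ht ω) hy).trans ?_
  refine (integral_add hm hps).trans_le (add_le_add (h_med μStar hμStar.1) ?_)
  rw [integral_finsetSum _ fun i _ => hp i]
  calc _ ≤ ∑ _i : Fin n, 4 * ρ := Finset.sum_le_sum fun i _ => by
        rw [integral_const_mul]
        exact mul_le_mul_of_nonneg_left (h_player i (y i) (hy i)) (by norm_num)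
    _ = 4 * n * ρ := by simp; ring

/-- Expected regret bounds imply bounds on all performance measures. -/
theorem performance_le (h : IsRandomPlay T μ x) (P : Measure Ω) [IsProbabilityMeasure P]
    (hT : 0 < T) {G : Game A} {α lam lamStar ε ρ₀ ρ : ℝ} (h0 : 0 < α) (h1 : α ≤ 1 / 2)
    (hlam : 0 < lam) (hlamStar : G.IsExactMultiplier lamStar)
    (hε : ε = (ρ₀ + 4 * n * ρ) / T) (hεpos : 0 < ε)
    (h_med : ∀ ν ∈ mediatorStrategies A,
      ∫ ω, (∑ t ∈ Finset.range T, G.mediatorUtility α lam (x t ω) ν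
        - ∑ t ∈ Finset.range T, G.mediatorUtility α lam (x t ω) (μ t ω)) ∂P ≤ ρ₀)
    (h_player : ∀ i, ∀ y ∈ playerStrategies A i,
      ∫ ω, 1 / (Game.paymentBound + 1) *
        (∑ t ∈ Finset.range T, G.playerUtility α (μ t ω) (x t ω) i y
        - ∑ t ∈ Finset.range T, G.playerUtility α (μ t ω) (x t ω) i (x t ω i)) ∂P ≤ ρ) :
    ∃ δ ≤ ε / α + n * lamStar / lam,
      (∀ i, ∫ ω, G.averagePayment α T (fun t => μ t ω) (fun t => x t ω) i ∂P
        ≤ 2 * α + 2 * (maxActions A * δ)) ∧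
      ∫ ω, directnessGap T (fun t => x t ω) ∂P ≤ 2 * Fintype.card (Profile A) * δ ∧
      ∀ μStar, G.IsOptimalEquilibrium μStar →
        ∫ ω, G.optimalityGap T (fun t => μ t ω) (fun t => x t ω) μStar ∂P
          ≤ 2 * (ε * lam) + maxActions A * δ ∧
        ∫ ω, G.optimalityGap T (fun t => explored α (μ t ω)) (fun t => x t ω) μStar ∂P
          ≤ 2 * (ε * lam) + maxActions A * δ + α := by
  have h1' : α ≤ 1 := by linarith
  have hdev := h.integrable_averageDeviation P
  have hδ0 : 0 ≤ ∫ ω, averageDeviation T (fun t => x t ω) ∂P :=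
    integral_nonneg h.averageDeviation_nonneg
  have H : ∀ {μStar}, G.IsOptimalEquilibrium μStar → ∀ y : ∀ i, A i → A i → ℝ,
      (∀ i, y i ∈ playerStrategies A i) → G.regretCertificate α lam μStar
        (fun r => ∫ ω, averageMediator T (fun t => μ t ω) r ∂P)
        (∫ ω, averageDeviation T (fun t => x t ω) ∂P) y ≤ ε := fun hS y hy =>
    hε ▸ h.regretCertificate_le P hT h1' h_med h_player hS.1 hy
  refine ⟨∫ ω, averageDeviation T (fun t => x t ω) ∂P, ?_, fun i => ?_, ?_, fun μStar hS => ?_⟩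
  · rcases le_or_gt lamStar lam with hle | hlt
    · obtain ⟨μStar, hS⟩ := hlamStar.exists_isOptimalEquilibrium
      exact Game.deviation_le_of_regretCertificate_le h0 h1' hlam hlamStar hle hS
        (h.integral_averageMediator_mem P hT) (H hS)
    -- For `lam < lamStar` exactness says nothing, but then `n * lamStar / lam` exceeds the trivial
    -- bound `n`.
    · have hn : ∫ ω, averageDeviation T (fun t => x t ω) ∂P ≤ n := by
        refine (integral_mono hdev (integrable_const (n : ℝ)) fun ω =>
          averageDeviation_le hT fun t ht => h.player_mem t ht ω).trans_eq (by simp)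
      have : (n : ℝ) ≤ n * lamStar / lam := by
        rw [le_div_iff₀ hlam]
        exact mul_le_mul_of_nonneg_left hlt.le (by positivity)
      have : 0 < ε / α := div_pos hεpos h0
      linarith
  · refine (integral_mono (h.integrable_averagePayment P G α i)
      ((integrable_const (2 * α)).add ((hdev.const_mul (maxActions A : ℝ)).const_mul 2)) fun ω =>
        G.averagePayment_le h0.le h1' hT (fun t ht => h.med_mem t ht ω)
          (fun t ht => h.player_mem t ht ω) i).trans_eq ?_
    refine (integral_add (integrable_const _)
      ((hdev.const_mul (maxActions A : ℝ)).const_mul 2)).trans ?_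
    simp only [integral_const_mul]
    simp
  · refine (integral_mono (h.integrable_directnessGap P)
      (hdev.const_mul (2 * (Fintype.card (Profile A) : ℝ))) fun ω =>
        directnessGap_le hT fun t ht => h.player_mem t ht ω).trans_eq ?_
    rw [integral_const_mul]
  · have hv := Game.value_sub_le_of_regretCertificate_le h0.le h1 hlam hδ0 (H hS) hεpos.le
    have hval := h.integrable_value P G.u0 (direct A)
    have hgap : ∫ ω, G.optimalityGap T (fun t => μ t ω) (fun t => x t ω) μStar ∂P
        ≤ 2 * (ε * lam) + maxActions A * ∫ ω, averageDeviation T (fun t => x t ω) ∂P := by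
      have hsub := (integrable_const (value G.u0 μStar (direct A))).sub hval
      refine (integral_mono (h.integrable_optimalityGap P G μStar)
        (hsub.add (hdev.const_mul (maxActions A : ℝ))) fun ω =>
          G.optimalityGap_le (fun t ht => h.med_mem t ht ω)
            (fun t ht => h.player_mem t ht ω) μStar).trans ?_
      refine (integral_add hsub (hdev.const_mul _)).trans_le ?_
      rw [integral_const_mul]
      refine add_le_add_left ((integral_sub (integrable_const _) hval).trans_le ?_) _
      rw [h.integral_value P]
      simpa using hv
    refine ⟨hgap, ?_⟩
    refine (integral_mono (h.integrable_optimalityGap_explored P G α μStar)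
      ((h.integrable_optimalityGap P G μStar).add (integrable_const α)) fun ω =>
        G.optimalityGap_explored_le h0.le hT (fun t ht => h.med_mem t ht ω)
          (fun t ht => h.player_mem t ht ω) μStar).trans ?_
    refine (integral_add (h.integrable_optimalityGap P G μStar) (integrable_const α)).trans_le ?_
    simpa using hgap

end IsRandomPlay

namespace IsRun

variable {P : Measure Ω} [IsProbabilityMeasure P] {ℱ : Filtration ℕ mΩ} {α : ℝ} {T : ℕ}
    {μ : ℕ → Ω → Profile A → ℝ} {x : ℕ → Ω → ∀ i, A i → A i → ℝ} {o : ℕ → Ω → Outcome A}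

/-- There are finitely many outcomes, so `f (o t ω)` is a finite combination of indicators, and the
tower property applies to each. Adaptivity of the strategies is harmless. -/
theorem integral_outcome (h : IsRun P ℱ α T μ x o) {t : ℕ} (ht : t < T) (f : Outcome A → ℝ) :
    Integrable (fun ω => f (o t ω)) P ∧
      ∫ ω, f (o t ω) ∂P = ∫ ω, expect α (μ t ω) (x t ω) f ∂P := by
  have hsum : (fun ω => f (o t ω))
      = fun ω => ∑ w, (o t ⁻¹' {w}).indicator (fun _ => (1 : ℝ)) ω * f w := by
    funext ω
    rw [Finset.sum_eq_single (o t ω) (fun w _ hw => ?_) (by simp)]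
    · simp
    · have hnot : ω ∉ o t ⁻¹' {w} := fun h => hw (Eq.symm h)
      rw [Set.indicator_of_notMem hnot, zero_mul]
  have hint : ∀ w, Integrable ((o t ⁻¹' {w}).indicator fun _ => (1 : ℝ)) P := fun w =>
    (integrable_const 1).indicator (ℱ.le (t + 1) _ (h.outcome_meas t ht w))
  have hlaw : ∀ w, Integrable (fun ω => roundLaw α (μ t ω) (x t ω) w) P := fun w =>
    h.isRandomPlay.integrable P ht (continuous_roundLaw α w)
  refine ⟨hsum ▸ integrable_finsetSum _ fun w _ => (hint w).mul_const _, ?_⟩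
  unfold expect
  rw [hsum, integral_finsetSum _ fun w _ => (hint w).mul_const _,
    integral_finsetSum _ fun w _ => (hlaw w).mul_const _]
  refine Finset.sum_congr rfl fun w _ => ?_
  rw [integral_mul_const, integral_mul_const, ← integral_condExp (ℱ.le t),
    integral_congr_ae (h.outcome_law t ht w)]

/-- Averages of realized quantities have the same mean as averages of conditional expectations. -/
theorem integral_average_outcome (h : IsRun P ℱ α T μ x o) (f : Outcome A → ℝ) :
    Integrable (fun ω => 1 / (T : ℝ) * ∑ t ∈ Finset.range T, f (o t ω)) P ∧
      ∫ ω, 1 / (T : ℝ) * ∑ t ∈ Finset.range T, f (o t ω) ∂P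
        = ∫ ω, 1 / (T : ℝ) * ∑ t ∈ Finset.range T, expect α (μ t ω) (x t ω) f ∂P := by
  have hint := fun t (ht : t ∈ Finset.range T) => h.integral_outcome (Finset.mem_range.1 ht) f
  refine ⟨(integrable_finsetSum _ fun t ht => (hint t ht).1).const_mul _, ?_⟩
  rw [integral_const_mul, integral_const_mul, integral_finsetSum _ fun t ht => (hint t ht).1,
    integral_finsetSum _ fun t ht => h.isRandomPlay.integrable P (Finset.mem_range.1 ht)
      (continuous_expect α f)]
  exact congrArg _ (Finset.sum_congr rfl fun t ht => (hint t ht).2)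

theorem integral_gap_played [∀ i, Nonempty (A i)] (h : IsRun P ℱ α T μ x o) (G : Game A)
    (μStar : Profile A → ℝ) :
    ∫ ω, (value G.u0 μStar (direct A)
        - 1 / (T : ℝ) * ∑ t ∈ Finset.range T, G.u0 (played (o t ω))) ∂P
      = ∫ ω, G.optimalityGap T (fun t => explored α (μ t ω)) (fun t => x t ω) μStar ∂P := by
  obtain ⟨hint, heq⟩ := h.integral_average_outcome fun w => G.u0 (played w)
  have hE := h.isRandomPlay.integrable_average P (continuous_expect α fun w => G.u0 (played w))
  rw [integral_sub (integrable_const _) hint, heq, ← integral_sub (integrable_const _) hE]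
  refine integral_congr_ae (Filter.Eventually.of_forall fun ω => ?_)
  simp only [Game.optimalityGap]
  congr 2
  exact Finset.sum_congr rfl fun t ht =>
    expect_played α G.u0 (h.med_mem t (Finset.mem_range.1 ht) ω) (x t ω)

end IsRun

end RandomStrategies

/-! ### Balancing the error terms. -/

section Parameters

/-- The choice of exploration probability and multiplier balances all error terms. -/
theorem bounds_of_parameters {Z b m α lam lamStar ε δ : ℝ} {n : ℕ} (hn : 0 < n) (hb : 1 ≤ b)
    (hm : 1 ≤ m) (hZ : Z = m * m) (hsize : n * b ≤ Z) (hεpos : 0 < ε) (hlamStar : 0 ≤ lamStar)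
    (hα : α = Z ^ (1 / 3 : ℝ) * (n : ℝ) ^ (-(2 / 3) : ℝ) * b ^ (1 / 3 : ℝ) * ε ^ (2 / 3 : ℝ))
    (hlam : lam = Z ^ (1 / 3 : ℝ) * (n : ℝ) ^ (1 / 3 : ℝ) * b ^ (1 / 3 : ℝ)
      * ε ^ (-(1 / 3) : ℝ))
    (hαle : α ≤ 1 / (2 * n)) (hδ : δ ≤ ε / α + n * lamStar / lam) :
    2 * α + 2 * (b * δ) ≤ 10 * max 1 lamStar * Z ^ (4 / 3 : ℝ) * ε ^ (1 / 3 : ℝ) ∧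
    2 * m * δ ≤ 10 * max 1 lamStar * Z ^ (4 / 3 : ℝ) * ε ^ (1 / 3 : ℝ) ∧
    2 * (ε * lam) + b * δ ≤ 10 * max 1 lamStar * Z ^ (4 / 3 : ℝ) * ε ^ (1 / 3 : ℝ) ∧
    2 * (ε * lam) + b * δ + α ≤ 10 * max 1 lamStar * Z ^ (4 / 3 : ℝ) * ε ^ (1 / 3 : ℝ) := by
  have hn1 : (1 : ℝ) ≤ n := by exact_mod_cast hn
  have hZ1 : 1 ≤ Z := by nlinarith
  have hmZ : m ≤ Z := by nlinarith
  have cube : ∀ {c : ℝ}, 0 ≤ c → (c ^ (1 / 3 : ℝ)) ^ 3 = c := fun {c} hc => by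
    rw [← Real.rpow_natCast, ← Real.rpow_mul hc]; norm_num
  have two : ∀ {c : ℝ}, 0 ≤ c → c ^ (2 / 3 : ℝ) = (c ^ (1 / 3 : ℝ)) ^ 2 := fun {c} hc => by
    rw [← Real.rpow_natCast, ← Real.rpow_mul hc]; norm_num
  have four : ∀ {c : ℝ}, 0 ≤ c → c ^ (4 / 3 : ℝ) = (c ^ (1 / 3 : ℝ)) ^ 4 := fun {c} hc => by
    rw [← Real.rpow_natCast, ← Real.rpow_mul hc]; norm_num
  have hz1 : 1 ≤ Z ^ (1 / 3 : ℝ) := Real.one_le_rpow hZ1 (by norm_num)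
  have hp1 : 1 ≤ (n : ℝ) ^ (1 / 3 : ℝ) := Real.one_le_rpow hn1 (by norm_num)
  have hq1 : 1 ≤ b ^ (1 / 3 : ℝ) := Real.one_le_rpow hb (by norm_num)
  have he0 : 0 < ε ^ (1 / 3 : ℝ) := Real.rpow_pos_of_pos hεpos _
  have hz3 := cube (zero_le_one.trans hZ1)
  have hp3 := cube (zero_le_one.trans hn1)
  have hq3 := cube (zero_le_one.trans hb)
  have he3 := cube hεpos.le
  rw [four (zero_le_one.trans hZ1)]
  rw [Real.rpow_neg (zero_le_one.trans hn1), two (zero_le_one.trans hn1), two hεpos.le] at hα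
  rw [Real.rpow_neg hεpos.le] at hlam
  -- In terms of the cube roots `z, p, q, e` of `Z, n, b, ε`, everything becomes rational algebra.
  generalize Z ^ (1 / 3 : ℝ) = z at *
  generalize (n : ℝ) ^ (1 / 3 : ℝ) = p at *
  generalize b ^ (1 / 3 : ℝ) = q at *
  generalize ε ^ (1 / 3 : ℝ) = e at *
  have hz0 : 0 < z := by linarith
  have hp0 : 0 < p := by linarith
  have hq0 : 0 < q := by linarith
  -- The cube root of the size assumption `n * b ≤ Z`.
  have hpq : p * q ≤ z := by
    refine le_of_pow_le_pow_left₀ three_ne_zero hz0.le ?_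
    rw [mul_pow, hp3, hq3, hz3]; exact hsize
  have hpz : p ≤ z := (le_mul_of_one_le_right hp0.le hq1).trans hpq
  set L := max 1 lamStar
  have hL1 : 1 ≤ L := le_max_left _ _
  have hLs : lamStar ≤ L := le_max_right _ _
  have hs : z * p * q * e ^ 2 ≤ 1 / 2 := by
    have : z * p * q * e ^ 2 = n * α := by rw [hα, ← hp3]; field_simp
    rw [this]
    calc n * α ≤ n * (1 / (2 * n)) := mul_le_mul_of_nonneg_left hαle (by linarith)
      _ = 1 / 2 := by field_simp
  -- The left side `s` equals `nα`, hence `s ≤ 1/2`, while `p * q ≤ z` gives `s ≤ (z * e)²`. So `s²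
  -- ≤ s ≤ (z * e)²`.
  have hze : z * p * q * e ^ 2 ≤ z * e := by
    refine le_of_pow_le_pow_left₀ two_ne_zero (by positivity) ?_
    have h1 : z * p * q * e ^ 2 ≤ z * e * (z * e) := by
      have := mul_le_mul_of_nonneg_left hpq (by positivity : 0 ≤ z * e ^ 2)
      linarith
    have h2 : 0 ≤ z * p * q * e ^ 2 := by positivity
    nlinarith
  have hαze : α ≤ z * e := by
    refine le_trans ?_ hze
    rw [hα]
    have : (p ^ 2)⁻¹ ≤ p := (inv_le_one_of_one_le₀ (one_le_pow₀ hp1)).trans hp1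
    gcongr
  have hεlam : ε * lam = z * p * q * e ^ 2 := by rw [hlam, ← he3]; field_simp
  have hδL : δ ≤ 2 * L * (p ^ 2 * e / (z * q)) := by
    -- The two errors in `δ` agree up to the factor `lamStar`: this is the balance behind `α` and
    -- `lam`.
    have heq : ε / α + n * lamStar / lam = (1 + lamStar) * (p ^ 2 * e / (z * q)) := by
      rw [hα, hlam, ← he3, ← hp3]; field_simp
    rw [heq] at hδ
    refine hδ.trans (mul_le_mul_of_nonneg_right (by linarith) (by positivity))
  have hbδ : b * δ ≤ 2 * L * (z * e) := by
    calc b * δ ≤ b * (2 * L * (p ^ 2 * e / (z * q))) :=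
          mul_le_mul_of_nonneg_left hδL (by linarith)
      _ = 2 * L * ((p * q) * (p * q) * e / z) := by rw [← hq3]; field_simp
      _ ≤ 2 * L * (z * z * e / z) := by gcongr
      _ = 2 * L * (z * e) := by field_simp
  -- The directness gap alone needs the exponent 4/3: `m ≤ Z = z ^ 3` contributes three of the four
  -- powers of `z`. The other errors are of order `L * (z * e)`.
  have hmδ : m * δ ≤ 2 * L * (z ^ 4 * e) := by
    calc m * δ ≤ m * (2 * L * (p ^ 2 * e / (z * q))) :=
          mul_le_mul_of_nonneg_left hδL (by linarith)
      _ ≤ z ^ 3 * (2 * L * (z ^ 2 * e / (z * 1))) := by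
          rw [← hz3] at hmZ
          gcongr
      _ = 2 * L * (z ^ 4 * e) := by field_simp
  have hze4 : z * e ≤ z ^ 4 * e := by
    gcongr
    exact le_self_pow₀ hz1 (by norm_num)
  have hL4 : z ^ 4 * e ≤ L * (z ^ 4 * e) := le_mul_of_one_le_left (by positivity) hL1
  have hbδ4 : b * δ ≤ 2 * (L * (z ^ 4 * e)) := by
    refine hbδ.trans ?_
    rw [mul_assoc]
    gcongr
  have hB : 10 * L * z ^ 4 * e = 10 * (L * (z ^ 4 * e)) := by ring
  rw [hB, hεlam]
  have hnn : 0 ≤ L * (z ^ 4 * e) := by positivity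
  refine ⟨?_, ?_, ?_, ?_⟩ <;> linarith

end Parameters

end NFSteer

theorem mainTheorem9 {n : ℕ} (hn : 0 < n) {A : Fin n → Type*}
    [∀ i, Fintype (A i)] [∀ i, DecidableEq (A i)] [∀ i, Nonempty (A i)]
    (G : NFSteer.Game A)
    -- `Z`: number of terminal nodes of the augmented game; `b`: largest number of actions
    (Z b : ℕ) (hZ : Z = Fintype.card (NFSteer.Terminal A)) (hb : b = NFSteer.maxActions A)
    (hsize : n * b ≤ Z)
    (lamStar : ℝ) (hlamStar : G.IsExactMultiplier lamStar)
    (R0 R : ℕ → ℝ) (T : ℕ) (ε α lam : ℝ)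
    (hε : ε = (R0 T + 4 * n * R T) / T) (hεpos : 0 < ε)
    (hα : α = (Z : ℝ) ^ (1 / 3 : ℝ) * (n : ℝ) ^ (-(2 / 3) : ℝ) * (b : ℝ) ^ (1 / 3 : ℝ)
      * ε ^ (2 / 3 : ℝ))
    (hlam : lam = (Z : ℝ) ^ (1 / 3 : ℝ) * (n : ℝ) ^ (1 / 3 : ℝ) * (b : ℝ) ^ (1 / 3 : ℝ)
      * ε ^ (-(1 / 3) : ℝ))
    (hT : α ≤ 1 / (2 * n)) :
    -- deterministic form, for arbitrary sequences of mixed strategies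
    (∀ (μ : ℕ → NFSteer.Profile A → ℝ) (x : ℕ → ∀ i, A i → A i → ℝ),
      (∀ t < T, μ t ∈ NFSteer.mediatorStrategies A) →
      (∀ t < T, ∀ i, x t i ∈ NFSteer.playerStrategies A i) →
      G.MediatorRegretLE α lam T μ x (R0 T) →
      (∀ i, G.PlayerRegretLE α T μ x i (R T)) →
      (∀ i, G.averagePayment α T μ x i
        ≤ 10 * max 1 lamStar * (Z : ℝ) ^ (4 / 3 : ℝ) * ε ^ (1 / 3 : ℝ)) ∧
      NFSteer.directnessGap T x
        ≤ 10 * max 1 lamStar * (Z : ℝ) ^ (4 / 3 : ℝ) * ε ^ (1 / 3 : ℝ) ∧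
      ∀ μStar, G.IsOptimalEquilibrium μStar →
        G.optimalityGap T μ x μStar
          ≤ 10 * max 1 lamStar * (Z : ℝ) ^ (4 / 3 : ℝ) * ε ^ (1 / 3 : ℝ) ∧
        G.optimalityGap T (fun t => NFSteer.explored α (μ t)) x μStar
          ≤ 10 * max 1 lamStar * (Z : ℝ) ^ (4 / 3 : ℝ) * ε ^ (1 / 3 : ℝ)) ∧
    -- random runs, with adaptive strategies, expected regrets, and realized payments and play
    (∀ {Ω : Type*} {mΩ : MeasurableSpace Ω} (P : MeasureTheory.Measure Ω)
      [MeasureTheory.IsProbabilityMeasure P] (ℱ : MeasureTheory.Filtration ℕ mΩ)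
      (μ : ℕ → Ω → NFSteer.Profile A → ℝ) (x : ℕ → Ω → ∀ i, A i → A i → ℝ)
      (o : ℕ → Ω → NFSteer.Outcome A),
      NFSteer.IsRun P ℱ α T μ x o →
      (∀ ν ∈ NFSteer.mediatorStrategies A,
        ∫ ω, (∑ t ∈ Finset.range T, G.mediatorUtility α lam (x t ω) ν
          - ∑ t ∈ Finset.range T, G.mediatorUtility α lam (x t ω) (μ t ω)) ∂P ≤ R0 T) →
      (∀ i, ∀ y ∈ NFSteer.playerStrategies A i,
        ∫ ω, 1 / (NFSteer.Game.paymentBound + 1) *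
          (∑ t ∈ Finset.range T, G.playerUtility α (μ t ω) (x t ω) i y
          - ∑ t ∈ Finset.range T, G.playerUtility α (μ t ω) (x t ω) i (x t ω i)) ∂P ≤ R T) →
      (∀ i, ∫ ω, (1 / (T : ℝ) * ∑ t ∈ Finset.range T, G.payment i (o t ω)) ∂P
        ≤ 10 * max 1 lamStar * (Z : ℝ) ^ (4 / 3 : ℝ) * ε ^ (1 / 3 : ℝ)) ∧
      ∫ ω, NFSteer.directnessGap T (fun t => x t ω) ∂P
        ≤ 10 * max 1 lamStar * (Z : ℝ) ^ (4 / 3 : ℝ) * ε ^ (1 / 3 : ℝ) ∧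
      ∀ μStar, G.IsOptimalEquilibrium μStar →
        ∫ ω, (NFSteer.value G.u0 μStar (NFSteer.direct A)
            - 1 / (T : ℝ) * ∑ t ∈ Finset.range T, G.u0 (NFSteer.played (o t ω))) ∂P
          ≤ 10 * max 1 lamStar * (Z : ℝ) ^ (4 / 3 : ℝ) * ε ^ (1 / 3 : ℝ)) := by
  have hT0 : 0 < T := by
    -- For `T = 0`, division by zero would make `ε = 0`.
    rcases Nat.eq_zero_or_pos T with rfl | h
    · rw [hε] at hεpos; simp at hεpos
    · exact h
  have hb1 : 1 ≤ b := hb ▸ NFSteer.maxActions_pos_of hn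
  have hm1 : 1 ≤ Fintype.card (NFSteer.Profile A) := Fintype.card_pos
  have hZm : (Z : ℝ) = Fintype.card (NFSteer.Profile A) * Fintype.card (NFSteer.Profile A) := by
    rw [hZ, Fintype.card_prod]; push_cast; ring
  have hn0 : (0 : ℝ) < n := by exact_mod_cast hn
  have hb0 : (0 : ℝ) < b := by exact_mod_cast hb1
  have hZ0 : (0 : ℝ) < Z := by rw [hZm]; positivity
  have hα0 : 0 < α := by rw [hα]; positivity
  have hlam0 : 0 < lam := by rw [hlam]; positivity
  have hα2 : α ≤ 1 / 2 := by
    refine hT.trans (one_div_le_one_div_of_le two_pos ?_)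
    have : (1 : ℝ) ≤ n := by exact_mod_cast hn
    linarith
  have bounds := fun {δ : ℝ} => NFSteer.bounds_of_parameters (δ := δ) hn
    (by exact_mod_cast hb1 : (1 : ℝ) ≤ b) (by exact_mod_cast hm1) hZm (by exact_mod_cast hsize)
    hεpos hlamStar.1 hα hlam hT
  refine ⟨fun μ x hμ hx hmed hplayer => ?_, fun P _ ℱ μ x o hrun hmed hplayer => ?_⟩
  -- Deterministic sequences are random ones on a one-point space with the Dirac measure, where
  -- integrals are evaluations.
  · have hplay : NFSteer.IsRandomPlay (Ω := Unit) T (fun t _ => μ t) (fun t _ => x t) :=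
      ⟨fun t ht _ => hμ t ht, fun _ _ _ => measurable_const, fun t ht _ => hx t ht,
        fun _ _ _ _ _ => measurable_const⟩
    obtain ⟨δ, hδ, hpay, hdir, hopt⟩ := hplay.performance_le (Measure.dirac ()) hT0 hα0 hα2 hlam0
      hlamStar hε hεpos (fun ν hν => by simpa using hmed ν hν)
      (fun i y hy => by simpa using hplayer i y hy)
    obtain ⟨h1, h2, h3, h4⟩ := bounds hδ
    simp only [integral_dirac, ← hb] at hpay hdir hopt
    exact ⟨fun i => (hpay i).trans h1, hdir.trans h2, fun μStar hS =>
      ⟨(hopt μStar hS).1.trans h3, (hopt μStar hS).2.trans h4⟩⟩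
  · obtain ⟨δ, hδ, hpay, hdir, hopt⟩ := hrun.isRandomPlay.performance_le P hT0 hα0 hα2 hlam0
      hlamStar hε hεpos hmed hplayer
    obtain ⟨h1, h2, h3, h4⟩ := bounds hδ
    rw [← hb] at hpay hopt
    refine ⟨fun i => ?_, hdir.trans h2, fun μStar hS => ?_⟩
    · rw [(hrun.integral_average_outcome (G.payment i)).2]
      exact (hpay i).trans h1
    · rw [hrun.integral_gap_played G μStar]
      exact (hopt μStar hS).2.trans h4
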